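/- **Notation.** $D^2\subset\mathbb C$ is the open unit disc. For $p\ge 1$, $q\ge 2$ let $B_{p,q}=\sigma_{q-1}\sigma_{q-2}\cdots\sigma_2\,\sigma_1^{2p-1}$ be a braid on $q$ strands, and let $\hat B_{p,q}\subset S^1\times D^2$ be a smooth closed braid, transverse to the discs $\{\mathrm{pt}\}\times D^2$, which is a closure of $B_{p,q}$ (the solid torus $S^1\times D^2$ is the exterior of the braid axis $A$, and $S^1\times\{0\}$ is a meridian of $A$). For $0<\varepsilon\le 1$ let $\varepsilon\hat B_{p,q}$ be the isotopic closed braid obtained by multiplying the $D^2$-coordinate by $\varepsilon$. Let $(X,\omega)$ be a symplectic $4$-manifold and let $F\subset X$ be a symplectic torus of self-intersection $0$ together with a smooth identification $\nu F\cong S^1\times(S^1\times D^2)$ of a tubular neighbourhood, under which $F=S^1\times(S^1\times\{0\})$; for example, $X=E(1)$ or $X=E(n)$, with a symplectic form for which the regular fiber $F$ is symplectic. Orient symplectic surfaces by $\omega$. **Lemma 2.2.** Let $$T_{p,q}=S^1\times \varepsilon\hat B_{p,q}\subset S^1\times(S^1\times D^2)\cong\nu F\subset X .$$ 1. For every $0<\varepsilon\le1$,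 $T_{p,q}$ is a smoothly embedded torus in $X$ which, suitably oriented, represents the homology class $q[F]\in H_2(X;\mathbb Z)$. 2. $T_{p,q}$ is a symplectic submanifold of $(X,\omega)$, and with its symplectic orientation it represents $q[F]$, in each of the following cases: for all $\varepsilon\in(0,1]$, if $\omega$ is a product form on $\nu F\cong (S^1\times S^1)\times D^2$ (or, more generally, if the slices $S^1\times S^1\times\{z\}$ and $\{y\}\times D^2$ are everywhere $\omega$-orthogonal); and for all sufficiently small $\varepsilon>0$, for an arbitrary identification of $\nu F$. -/

import Mathlib

open CategoryTheory AlgebraicTopology Manifold Set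
open scoped ContDiff

noncomputable section

namespace BraidTori

/-! ### Symplectic 4-manifolds -/

/-- The model space of real 4-manifolds. -/
abbrev E4 : Type := EuclideanSpace ℝ (Fin 4)

/-- A (not yet smooth) field of alternating bilinear forms on the tangent spaces of a 4-manifold. -/
abbrev TwoForm (X : Type) [TopologicalSpace X] [ChartedSpace E4 X] : Type :=
  (x : X) → TangentSpace (𝓡 4) x [⋀^Fin 2]→L[ℝ] ℝ

/-- The coordinate expression of a 2-form in a chart `e`: its pull-back under `e⁻¹`. -/
def TwoForm.inChart {X : Type} [TopologicalSpace X] [ChartedSpace E4 X]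
    (Ω : TwoForm X) (e : OpenPartialHomeomorph X E4) (y : E4) : E4 [⋀^Fin 2]→L[ℝ] ℝ :=
  (Ω (e.symm y)).compContinuousLinearMap (mfderiv 𝓘(ℝ, E4) (𝓡 4) e.symm y)

/-- A symplectic form: a smooth, closed, nondegenerate 2-form. Smoothness and closedness are
expressed in the charts of the atlas. -/
structure IsSymplecticForm {X : Type} [TopologicalSpace X] [ChartedSpace E4 X]
    (Ω : TwoForm X) : Prop where
  smooth : ∀ e ∈ atlas E4 X, ContDiffOn ℝ ∞ (Ω.inChart e) e.target
  closed : ∀ e ∈ atlas E4 X, ∀ y ∈ e.target, extDeriv (Ω.inChart e) y = 0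
  nondegenerate : ∀ (x : X) (v : TangentSpace (𝓡 4) x), v ≠ 0 →
    ∃ w : TangentSpace (𝓡 4) x, Ω x ![v, w] ≠ 0

/-! ### Tori in 4-manifolds -/

/-- The standard torus `S¹ × S¹`. -/
abbrev Torus : Type := Circle × Circle

/-- The model with corners of the standard torus. -/
abbrev torusModel : ModelWithCorners ℝ (EuclideanSpace ℝ (Fin 1) × EuclideanSpace ℝ (Fin 1))
    (ModelProd (EuclideanSpace ℝ (Fin 1)) (EuclideanSpace ℝ (Fin 1))) :=
  (𝓡 1).prod (𝓡 1)

/-- A smooth embedding of the torus: a smooth immersion which is a topological embedding. -/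
structure IsSmoothTorus {X : Type} [TopologicalSpace X] [ChartedSpace E4 X]
    (f : Torus → X) : Prop where
  contMDiff : ContMDiff torusModel (𝓡 4) ∞ f
  immersion : ∀ y : Torus, Function.Injective (mfderiv torusModel (𝓡 4) f y)
  isEmbedding : Topology.IsEmbedding f

/-- The pull-back `f^*Ω` is nondegenerate on every tangent plane of the torus. For an embedding `f`
this says that the image of `f` is a symplectic submanifold. -/
def IsSymplecticMap {X : Type} [TopologicalSpace X] [ChartedSpace E4 X]
    (Ω : TwoForm X) (f : Torus → X) : Prop :=
  ∀ (y : Torus) (v : TangentSpace torusModel y), v ≠ 0 → ∃ w : TangentSpace torusModel y,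
    Ω (f y) ![mfderiv torusModel (𝓡 4) f y v, mfderiv torusModel (𝓡 4) f y w] ≠ 0

/-- The value of `f^*Ω` on the standard frame `(∂/∂s, ∂/∂t)` of the torus at the point
`(exp (i s), exp (i t))`. -/
def areaDensity {X : Type} [TopologicalSpace X] [ChartedSpace E4 X]
    (Ω : TwoForm X) (f : Torus → X) (s t : ℝ) : ℝ :=
  Ω (f (Circle.exp s, Circle.exp t))
    ![mfderiv 𝓘(ℝ, ℝ) (𝓡 4) (fun u : ℝ => f (Circle.exp u, Circle.exp t)) s (1 : ℝ),
      mfderiv 𝓘(ℝ, ℝ) (𝓡 4) (fun u : ℝ => f (Circle.exp s, Circle.exp u)) t (1 : ℝ)]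

/-- The area forms `f^*Ω` and `g^*Ω` induce the same orientation of the standard torus. -/
def SameOrientation {X : Type} [TopologicalSpace X] [ChartedSpace E4 X]
    (Ω : TwoForm X) (f g : Torus → X) : Prop :=
  ∀ s t s' t' : ℝ, 0 < areaDensity Ω f s t * areaDensity Ω g s' t'

/-! ### The fundamental class of the torus and the classes of maps of tori -/

/-- The singular simplicial set of a space. -/
abbrev sing (X : Type) [TopologicalSpace X] : SSet.{0} := TopCat.toSSet.obj (TopCat.of X)

/-- Integral singular homology in degree 2. -/
abbrev H2 (X : Type) [TopologicalSpace X] : ModuleCat.{0} ℤ :=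
  ((singularHomologyFunctor (ModuleCat.{0} ℤ) 2).obj (ModuleCat.of ℤ ℤ)).obj (TopCat.of X)

/-- The map `(s, t) ↦ (exp (2 π i s), exp (2 π i t))` from the plane onto the torus. -/
def torusCover : C(ℝ × ℝ, Torus) where
  toFun x := (Circle.exp (2 * Real.pi * x.1), Circle.exp (2 * Real.pi * x.2))
  continuous_toFun := by fun_prop

theorem continuous_coord (i : Fin 3) : Continuous fun x : stdSimplex ℝ (Fin 3) => x.1 i :=
  (continuous_apply i).comp continuous_subtype_val

/-- The lower triangle, with vertices `(0,0), (1,0), (1,1)`, of the unit square, mapped to the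
torus. -/
def lowerTriangle : C(stdSimplex ℝ (Fin 3), Torus) :=
  torusCover.comp ⟨fun x => (x.1 1 + x.1 2, x.1 2),
    ((continuous_coord 1).add (continuous_coord 2)).prodMk (continuous_coord 2)⟩

/-- The upper triangle, with vertices `(0,0), (0,1), (1,1)`, of the unit square, mapped to the
torus. -/
def upperTriangle : C(stdSimplex ℝ (Fin 3), Torus) :=
  torusCover.comp ⟨fun x => (x.1 2, x.1 1 + x.1 2),
    (continuous_coord 2).prodMk ((continuous_coord 1).add (continuous_coord 2))⟩

section SingularChains

open scoped Simplicial

/-- A continuous map from the standard triangle as a 2-simplex of the singular simplicial set. -/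
def simplexOf (σ : C(stdSimplex ℝ (Fin 3), Torus)) : (sing Torus) _⦋2⦌ :=
  ((TopCat.of Torus).toSSetObjEquiv (.op ⦋2⦌)).symm σ

/-- The singular 2-chain `lower triangle - upper triangle`, that is, the unit square with its
standard orientation and with opposite sides identified. -/
def torusChain : ModuleCat.of ℤ ℤ ⟶ ((sing Torus).chainComplex (ModuleCat.of ℤ ℤ)).X 2 :=
  (sing Torus).ιChainComplex (simplexOf lowerTriangle) -
    (sing Torus).ιChainComplex (simplexOf upperTriangle)

theorem simplexOf_d (σ : C(stdSimplex ℝ (Fin 3), Torus)) (i : Fin 3) :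
    (sing Torus).δ i (simplexOf σ) = ((TopCat.of Torus).toSSetObjEquiv (.op ⦋1⦌)).symm
      (σ.comp ⟨stdSimplex.map (SimplexCategory.δ i), stdSimplex.continuous_map _⟩) := rfl

theorem face_coord (i k : Fin 3) (x : stdSimplex ℝ (Fin 2)) :
    (stdSimplex.map (SimplexCategory.δ i) x).1 k =
      (if i.succAbove 0 = k then x.1 0 else 0) + (if i.succAbove 1 = k then x.1 1 else 0) := by
  have := FunOnFinite.linearMap_apply_apply ℝ ℝ (SimplexCategory.δ i : Fin 2 → Fin 3) x.1 k
  rw [Finset.sum_filter, Fin.sum_univ_two] at this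
  exact this

theorem torusCover_eq {s t s' t' : ℝ} (hs : ∃ m : ℤ, s = s' + m) (ht : ∃ m : ℤ, t = t' + m) :
    torusCover (s, t) = torusCover (s', t') := by
  obtain ⟨m, rfl⟩ := hs
  obtain ⟨n, rfl⟩ := ht
  refine Prod.ext (Circle.exp_eq_exp.2 ⟨m, ?_⟩) (Circle.exp_eq_exp.2 ⟨n, ?_⟩) <;> dsimp <;> ring

theorem face_eq {σ τ : C(stdSimplex ℝ (Fin 3), Torus)} {i j : Fin 3}
    (h : ∀ x : stdSimplex ℝ (Fin 2), σ (stdSimplex.map (SimplexCategory.δ i) x) =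
      τ (stdSimplex.map (SimplexCategory.δ j) x)) :
    (sing Torus).δ i (simplexOf σ) = (sing Torus).δ j (simplexOf τ) := by
  rw [simplexOf_d, simplexOf_d]
  congr 1
  ext x : 1
  exact h x

theorem torusChain_d :
    torusChain ≫ ((sing Torus).chainComplex (ModuleCat.of ℤ ℤ)).d 2 1 = 0 := by
  have hx : ∀ x : stdSimplex ℝ (Fin 2), x.1 0 + x.1 1 = 1 := fun x => by
    have := x.2.2
    rwa [Fin.sum_univ_two] at this
  have f0 : ∀ x : stdSimplex ℝ (Fin 2), (stdSimplex.map (SimplexCategory.δ (0 : Fin 3)) x).1 1 = x.1 0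
      ∧ (stdSimplex.map (SimplexCategory.δ (0 : Fin 3)) x).1 2 = x.1 1 := fun x => by
    constructor <;> (rw [face_coord]; simp [show (0 : Fin 3).succAbove (0 : Fin 2) = 1 from rfl,
      show (0 : Fin 3).succAbove (1 : Fin 2) = 2 from rfl])
  have f1 : ∀ x : stdSimplex ℝ (Fin 2), (stdSimplex.map (SimplexCategory.δ (1 : Fin 3)) x).1 1 = 0
      ∧ (stdSimplex.map (SimplexCategory.δ (1 : Fin 3)) x).1 2 = x.1 1 := fun x => by
    constructor <;> (rw [face_coord]; simp [show (1 : Fin 3).succAbove (0 : Fin 2) = 0 from rfl,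
      show (1 : Fin 3).succAbove (1 : Fin 2) = 2 from rfl])
  have f2 : ∀ x : stdSimplex ℝ (Fin 2), (stdSimplex.map (SimplexCategory.δ (2 : Fin 3)) x).1 1 = x.1 1
      ∧ (stdSimplex.map (SimplexCategory.δ (2 : Fin 3)) x).1 2 = 0 := fun x => by
    constructor <;> (rw [face_coord]; simp [show (2 : Fin 3).succAbove (0 : Fin 2) = 0 from rfl,
      show (2 : Fin 3).succAbove (1 : Fin 2) = 1 from rfl])
  have h1 : (sing Torus).δ 1 (simplexOf lowerTriangle) =
      (sing Torus).δ 1 (simplexOf upperTriangle) := by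
    refine face_eq fun x => torusCover_eq ⟨0, ?_⟩ ⟨0, ?_⟩ <;> rw [(f1 x).1, (f1 x).2] <;> simp
  have h2 : (sing Torus).δ 0 (simplexOf lowerTriangle) =
      (sing Torus).δ 2 (simplexOf upperTriangle) := by
    refine face_eq fun x => torusCover_eq ⟨1, ?_⟩ ⟨0, ?_⟩
    · rw [(f0 x).1, (f0 x).2, (f2 x).2, hx]; simp
    · rw [(f0 x).2, (f2 x).1, (f2 x).2]; simp
  have h3 : (sing Torus).δ 2 (simplexOf lowerTriangle) =
      (sing Torus).δ 0 (simplexOf upperTriangle) := by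
    refine face_eq fun x => torusCover_eq ⟨0, ?_⟩ ⟨-1, ?_⟩
    · rw [(f2 x).1, (f2 x).2, (f0 x).2]; simp
    · rw [(f2 x).2, (f0 x).1, (f0 x).2, hx]; simp
  rw [torusChain, Preadditive.sub_comp, SSet.ιChainComplex_d, SSet.ιChainComplex_d,
    Fin.sum_univ_three, Fin.sum_univ_three, h1, h2, h3]
  simp
  abel

/-- The fundamental class of the oriented torus `S¹ × S¹`. -/
def fundamentalClass : H2 Torus :=
  (((sing Torus).chainComplex (ModuleCat.of ℤ ℤ)).liftCycles torusChain 1 (by simp) torusChain_d ≫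
    ((sing Torus).chainComplex (ModuleCat.of ℤ ℤ)).homologyπ 2).hom (1 : ℤ)

/-- The homology class `f_*[S¹ × S¹]` carried by a map of the torus. -/
def torusClass {X : Type} [TopologicalSpace X] (f : C(Torus, X)) : H2 X :=
  (((singularHomologyFunctor (ModuleCat.{0} ℤ) 2).obj (ModuleCat.of ℤ ℤ)).map
    (TopCat.ofHom f)).hom fundamentalClass

end SingularChains

/-! ### Closed braids -/

/-- A smooth closed braid with `q` strands in the open solid torus `S¹ × D²`: the strands are smooth
functions of the time `t`, pairwise disjoint at each time, and after one turn they are permuted.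
The corresponding link in `S¹ × D²` is `{(exp (2 π i t), strand t j)}`; it is transverse to
the discs `{pt} × D²`. -/
structure ClosedBraid (q : ℕ) where
  strand : ℝ → Fin q → ℂ
  perm : Equiv.Perm (Fin q)
  smooth : ContDiff ℝ ∞ strand
  injective : ∀ t, Function.Injective (strand t)
  norm_lt : ∀ t j, ‖strand t j‖ < 1
  periodic : ∀ t j, strand (t + 1) j = strand t (perm j)

/-- The base position number `j` of a `q`-strand braid: `q` equidistant points on the real axis,
in increasing order for `0 ≤ j < q`, inside the unit disc. -/
def slot (q j : ℕ) : ℂ := (((2 * j + 1 - q : ℝ) / q : ℝ) : ℂ)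

/-- The elementary braid which exchanges the points at the positions `i` and `i + 1` by a half turn
about their midpoint, `0 ≤ u ≤ 1`; `halfTwist q i u j` is the point that starts at position `j`.
In one-based numbering it is the generator `σ_{i+1}` of the braid group. -/
def halfTwist (q i : ℕ) (u : ℝ) (j : ℕ) : ℂ :=
  if j = i then (slot q i + slot q (i + 1)) / 2 -
    Complex.exp (Real.pi * u * Complex.I) * ((slot q (i + 1) - slot q i) / 2)
  else if j = i + 1 then (slot q i + slot q (i + 1)) / 2 +
    Complex.exp (Real.pi * u * Complex.I) * ((slot q (i + 1) - slot q i) / 2)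
  else slot q j

/-- The geometric braid of a positive word: the elementary braids of the word are performed
one after the other, each in one unit of time; `wordBraid q w t j` is the position at
time `t ∈ [0, length w]` of the strand which starts at position `j`. -/
def wordBraid (q : ℕ) : List ℕ → ℝ → ℕ → ℂ
  | [], _, j => slot q j
  | i :: w, t, j =>
    if t ≤ 1 then halfTwist q i t j else wordBraid q w (t - 1) (Equiv.swap i (i + 1) j)

/-- The word `σ_{q-1} σ_{q-2} ⋯ σ_2 σ_1^{2p-1}`; the letter `σ_{i+1}` is written `i`. -/
def braidWord (p q : ℕ) : List ℕ :=
  (List.range (q - 2)).reverse.map (· + 1) ++ List.replicate (2 * p - 1) 0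

/-- `β` is a closure of the braid `B_{p,q} = σ_{q-1} σ_{q-2} ⋯ σ_2 σ_1^{2p-1}`: it can be deformed
through (continuous) closed braids, up to the numbering of the strands, to the closure of the
geometric braid of this word. -/
def ClosedBraid.IsClosureB {q : ℕ} (β : ClosedBraid q) (p : ℕ) : Prop :=
  ∃ (h : ℝ → ℝ → Fin q → ℂ) (ρ τ : Equiv.Perm (Fin q)),
    ContinuousOn (fun x : ℝ × ℝ => h x.1 x.2) (Icc 0 1 ×ˢ Icc 0 1) ∧
    (∀ s ∈ Icc (0 : ℝ) 1, ∀ t ∈ Icc (0 : ℝ) 1,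
      Function.Injective (h s t) ∧ ∀ j, ‖h s t j‖ < 1) ∧
    (∀ s ∈ Icc (0 : ℝ) 1, ∀ j, h s 1 j = h s 0 (ρ j)) ∧
    (∀ t ∈ Icc (0 : ℝ) 1, ∀ j, h 0 t j = β.strand t j) ∧
    (∀ t ∈ Icc (0 : ℝ) 1, ∀ j,
      h 1 t j = wordBraid q (braidWord p q) ((braidWord p q).length * t) (τ j))

/-! ### Framed neighbourhoods of tori and the braided tori in them -/

/-- An identification of an open subset `νF` of `X` with `S¹ × S¹ × D²`, where `D²` is the open
unit disc: a diffeomorphism from `(S¹ × S¹) × D²` onto an open subset of `X`. It is a trivialised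
tubular neighbourhood of the torus `F`, the image of `(S¹ × S¹) × {0}`. -/
structure FramedNeighbourhood (X : Type) [TopologicalSpace X] [ChartedSpace E4 X] where
  toOpenPartialHomeomorph : OpenPartialHomeomorph (Torus × ℂ) X
  source_eq : toOpenPartialHomeomorph.source = {x | ‖x.2‖ < 1}
  contMDiffOn : ContMDiffOn (torusModel.prod 𝓘(ℝ, ℂ)) (𝓡 4) ∞ toOpenPartialHomeomorph
    toOpenPartialHomeomorph.source
  contMDiffOn_symm : ContMDiffOn (𝓡 4) (torusModel.prod 𝓘(ℝ, ℂ)) ∞ toOpenPartialHomeomorph.symm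
    toOpenPartialHomeomorph.target

namespace FramedNeighbourhood

variable {X : Type} [TopologicalSpace X] [ChartedSpace E4 X]

/-- The point of `νF` with the given coordinates. -/
def point (Φ : FramedNeighbourhood X) (y : Torus) (z : ℂ) : X :=
  Φ.toOpenPartialHomeomorph (y, z)

/-- The parametrised core torus `F = S¹ × S¹ × {0}`. -/
def core (Φ : FramedNeighbourhood X) : C(Torus, X) where
  toFun y := Φ.point y 0
  continuous_toFun := by
    refine Φ.toOpenPartialHomeomorph.continuousOn.comp_continuous (by fun_prop) fun y => ?_
    rw [Φ.source_eq]
    simp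

/-- The set `S¹ × (closed braid) ⊆ S¹ × (S¹ × D²) = νF`, where the closed braid has been shrunk
towards the core `S¹ × {0}` of the solid torus by the factor `ε`. -/
def braidTorus (Φ : FramedNeighbourhood X) {q : ℕ} (β : ClosedBraid q) (ε : ℝ) : Set X :=
  {x | ∃ (a : Circle) (t : ℝ) (j : Fin q),
    x = Φ.point (a, Circle.exp (2 * Real.pi * t)) (ε * β.strand t j)}

/-- At every point of `νF` the torus slice `S¹ × S¹ × {z}` and the disc slice `{y} × D²` are
`Ω`-orthogonal. This holds in particular if `Ω` is a product form on `νF`. -/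
def HasOrthogonalSlices (Φ : FramedNeighbourhood X) (Ω : TwoForm X) : Prop :=
  ∀ (y : Torus) (z : ℂ), ‖z‖ < 1 → ∀ (v : TangentSpace torusModel y) (w : ℂ),
    Ω (Φ.point y z) ![mfderiv torusModel (𝓡 4) (fun y' => Φ.point y' z) y v,
      mfderiv 𝓘(ℝ, ℂ) (𝓡 4) (fun z' => Φ.point y z') z w] = 0

end FramedNeighbourhood

end BraidTori

end

/-! The monodromy of `B_{p,q}` is a `q`-cycle: the descending word cycles the nonzero positions, and
the odd power of `σ_1` joins position `0` to that cycle (`wordPerm_braidWord`). One strand followed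
through `q` turns therefore closes up and traces the whole closed braid
(`ClosedBraid.IsClosureB.exists_strand`). So the braided torus is the image of a multisection `(a,
b) ↦ ((a, b ^ q), w b)`, where `w` is this loop scaled by `ε`.

Such a map is an immersion because its torus component is a `q`-fold covering, and it is injective
because distinct strands never meet. Shrinking `w` to `0` is a homotopy to the core precomposed with
`(a, b) ↦ (a, b ^ q)`, and that covering multiplies the fundamental class by `q`
(`torusClass_torusPow`).

The area density of a multisection is `q Ω(∂s, ∂t) + Ω(∂s, w')` (`areaDensity_multisection`).
Orthogonal slices kill the second term, and nondegeneracy keeps the first nonzero, hence of constant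
sign, on the connected neighbourhood. For a general framing the second term tends to `0` with `ε`
while the first tends to `q` times the density of the symplectic core; compactness of the torus
makes this uniform and yields `ε₀`. -/

open CategoryTheory AlgebraicTopology Manifold Set
open scoped ContDiff
noncomputable section
namespace BraidTori

/-! ### Homology: the covering `(a, b) ↦ (a, b ^ q)` has degree `q` -/

section Homology

open scoped Simplicial

/-- The integral singular chain complex of the torus. -/
abbrev torusChains : ChainComplex (ModuleCat.{0} ℤ) ℕ :=
  (sing Torus).chainComplex (ModuleCat.of ℤ ℤ)

/-- The singular simplex of the torus covered by the affine simplex of the plane with vertices `v`. -/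
def affineMap {n : ℕ} (v : Fin (n + 1) → ℝ × ℝ) : C(stdSimplex ℝ (Fin (n + 1)), Torus) :=
  torusCover.comp ⟨fun x => ∑ i, x.1 i • v i, continuous_finsetSum _ fun i _ =>
    ((continuous_apply i).comp continuous_subtype_val).smul continuous_const⟩

/-- `affineMap` as an element of the singular simplicial set. -/
def affineSimplex {n : ℕ} (v : Fin (n + 1) → ℝ × ℝ) : (sing Torus) _⦋n⦌ :=
  ((TopCat.of Torus).toSSetObjEquiv (.op ⦋n⦌)).symm (affineMap v)

/-- Face inclusions are affine, so a face merely omits a vertex; boundaries become bookkeeping on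
vertex lists. -/
theorem affineSimplex_δ {n : ℕ} (v : Fin (n + 2) → ℝ × ℝ) (i : Fin (n + 2)) :
    (sing Torus).δ i (affineSimplex v) = affineSimplex (v ∘ i.succAbove) := by
  have h : (sing Torus).δ i (affineSimplex v) = ((TopCat.of Torus).toSSetObjEquiv (.op ⦋n⦌)).symm
      ((affineMap v).comp ⟨stdSimplex.map (SimplexCategory.δ i), stdSimplex.continuous_map _⟩) := rfl
  rw [h, affineSimplex]
  congr 1
  ext x : 1
  refine congrArg torusCover ?_
  change ∑ k, (stdSimplex.map (SimplexCategory.δ i) x).1 k • v k = ∑ k, x.1 k • v (i.succAbove k)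
  have hx : ∀ k, (stdSimplex.map (SimplexCategory.δ i) x).1 k
      = ∑ l, if i.succAbove l = k then x.1 l else 0 := fun k => by
    have := FunOnFinite.linearMap_apply_apply ℝ ℝ
      (SimplexCategory.δ i : Fin (n + 1) → Fin (n + 2)) x.1 k
    rw [Finset.sum_filter] at this
    exact this
  simp_rw [hx, Finset.sum_smul, ite_smul, zero_smul]
  rw [Finset.sum_comm]
  simp

/-- Barycentric coordinates sum to `1`, so moving all vertices by a lattice vector moves every point
by it, and the covering does not see it. -/
theorem affineSimplex_translate {n : ℕ} {v w : Fin (n + 1) → ℝ × ℝ} (m : ℤ × ℤ)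
    (h : ∀ i, v i = w i + ((m.1 : ℝ), (m.2 : ℝ))) : affineSimplex v = affineSimplex w := by
  rw [affineSimplex, affineSimplex]
  congr 1
  ext x : 1
  have hx : ∑ i, x.1 i = 1 := x.2.2
  have e : ∑ i, x.1 i • v i = ∑ i, x.1 i • w i + ((m.1 : ℝ), (m.2 : ℝ)) := by
    simp_rw [h, smul_add, Finset.sum_add_distrib, ← Finset.sum_smul, hx, one_smul]
  change torusCover (∑ i, x.1 i • v i) = torusCover (∑ i, x.1 i • w i)
  rw [e]
  exact torusCover_eq ⟨m.1, rfl⟩ ⟨m.2, rfl⟩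

/-- The singular chain given by the rectangle `[0, 1] × [a, b]`. -/
def rectangleChain (a b : ℝ) : ModuleCat.of ℤ ℤ ⟶ torusChains.X 2 :=
  (sing Torus).ιChainComplex (affineSimplex ![(0, a), (1, a), (1, b)]) -
    (sing Torus).ιChainComplex (affineSimplex ![(0, a), (0, b), (1, b)])

theorem torusChain_eq_rectangleChain : torusChain = rectangleChain 0 1 := by
  have h1 : simplexOf lowerTriangle = affineSimplex ![(0, 0), (1, 0), (1, 1)] := by
    refine congrArg ((TopCat.of Torus).toSSetObjEquiv (.op ⦋2⦌)).symm ?_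
    ext x : 1
    refine congrArg torusCover (Prod.ext ?_ ?_) <;> simp [Fin.sum_univ_three]
  have h2 : simplexOf upperTriangle = affineSimplex ![(0, 0), (0, 1), (1, 1)] := by
    refine congrArg ((TopCat.of Torus).toSSetObjEquiv (.op ⦋2⦌)).symm ?_
    ext x : 1
    refine congrArg torusCover (Prod.ext ?_ ?_) <;> simp [Fin.sum_univ_three]
  rw [torusChain, h1, h2, rectangleChain]

/-- The diagonal cancels between the two triangles, and opposite sides are lattice translates of
each other; integrality of `b - a` serves the sides at heights `a` and `b`. -/
theorem rectangleChain_d (a b : ℝ) (m : ℤ) (h : b = a + m) :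
    rectangleChain a b ≫ torusChains.d 2 1 = 0 := by
  rw [rectangleChain, Preadditive.sub_comp, SSet.ιChainComplex_d, SSet.ιChainComplex_d,
    Fin.sum_univ_three, Fin.sum_univ_three]
  simp only [affineSimplex_δ]
  have e1 : affineSimplex (![(0, a), (1, a), (1, b)] ∘ (1 : Fin 3).succAbove) =
      affineSimplex (![(0, a), (0, b), (1, b)] ∘ (1 : Fin 3).succAbove) := by
    refine affineSimplex_translate 0 fun i => ?_
    fin_cases i <;> simp [Fin.succAbove]
  have e0 : affineSimplex (![(0, a), (1, a), (1, b)] ∘ (0 : Fin 3).succAbove) =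
      affineSimplex (![(0, a), (0, b), (1, b)] ∘ (2 : Fin 3).succAbove) := by
    refine affineSimplex_translate (1, 0) fun i => ?_
    fin_cases i <;> simp [Fin.succAbove, Fin.lt_def]
  have e2 : affineSimplex (![(0, a), (1, a), (1, b)] ∘ (2 : Fin 3).succAbove) =
      affineSimplex (![(0, a), (0, b), (1, b)] ∘ (0 : Fin 3).succAbove) := by
    refine affineSimplex_translate (0, -m) fun i => ?_
    fin_cases i <;> simp [Fin.succAbove, Fin.lt_def, h]
  rw [e0, e1, e2]
  simp
  abel

/-- The chain `D` is a flattened prism: the degenerate triangle with heights `a, b, c`, times the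
segment `[0, 1]`, cut into three tetrahedra. Its sides are the three rectangles. -/
theorem rectangleChain_add (a b c : ℝ) :
    ∃ D : ModuleCat.of ℤ ℤ ⟶ torusChains.X 3,
      rectangleChain a b + rectangleChain b c - rectangleChain a c = D ≫ torusChains.d 3 2 := by
  let S : (Fin 4 → ℝ × ℝ) → (ModuleCat.of ℤ ℤ ⟶ torusChains.X 3) := fun v =>
    (sing Torus).ιChainComplex (affineSimplex v)
  let T : (Fin 3 → ℝ × ℝ) → (ModuleCat.of ℤ ℤ ⟶ torusChains.X 2) := fun v =>
    (sing Torus).ιChainComplex (affineSimplex v)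
  have key : ∀ x y z w : ℝ × ℝ, S ![x, y, z, w] ≫ torusChains.d 3 2 =
      T ![y, z, w] - T ![x, z, w] + T ![x, y, w] - T ![x, y, z] := by
    intro x y z w
    have h0 : ![x, y, z, w] ∘ (0 : Fin 4).succAbove = ![y, z, w] := by
      ext i : 1; fin_cases i <;> rfl
    have h1 : ![x, y, z, w] ∘ (1 : Fin 4).succAbove = ![x, z, w] := by
      ext i : 1; fin_cases i <;> rfl
    have h2 : ![x, y, z, w] ∘ (2 : Fin 4).succAbove = ![x, y, w] := by
      ext i : 1; fin_cases i <;> rfl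
    have h3 : ![x, y, z, w] ∘ (3 : Fin 4).succAbove = ![x, y, z] := by
      ext i : 1; fin_cases i <;> rfl
    simp only [S, T]
    rw [SSet.ιChainComplex_d, Fin.sum_univ_four, affineSimplex_δ, affineSimplex_δ,
      affineSimplex_δ, affineSimplex_δ, h0, h1, h2, h3]
    simp [pow_succ]
    abel
  -- The two triangular ends of the prism differ by the lattice vector `(1, 0)`, so they cancel in
  -- the boundary.
  have top : T ![((1 : ℝ), a), (1, b), (1, c)] = T ![((0 : ℝ), a), (0, b), (0, c)] := by
    refine congrArg (sing Torus).ιChainComplex (affineSimplex_translate (1, 0) fun i => ?_)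
    fin_cases i <;> simp
  have rect : ∀ x y : ℝ, rectangleChain x y =
    T ![(0, x), (1, x), (1, y)] - T ![(0, x), (0, y), (1, y)] := fun _ _ => rfl
  refine ⟨-(S ![(0, a), (1, a), (1, b), (1, c)] - S ![(0, a), (0, b), (1, b), (1, c)]
    + S ![(0, a), (0, b), (0, c), (1, c)]), ?_⟩
  rw [Preadditive.neg_comp, Preadditive.add_comp, Preadditive.sub_comp, key, key, key, top,
    rect, rect, rect]
  abel

/-- The homology class of a 2-cycle of the torus. -/
def cycleClass (k : ModuleCat.of ℤ ℤ ⟶ torusChains.X 2) (hk : k ≫ torusChains.d 2 1 = 0) :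
    ModuleCat.of ℤ ℤ ⟶ H2 Torus :=
  torusChains.liftCycles k 1 (by simp) hk ≫ torusChains.homologyπ 2

theorem cycleClass_add {k l m : ModuleCat.of ℤ ℤ ⟶ torusChains.X 2}
    (hk : k ≫ torusChains.d 2 1 = 0) (hl : l ≫ torusChains.d 2 1 = 0)
    (hm : m ≫ torusChains.d 2 1 = 0)
    (h : ∃ D : ModuleCat.of ℤ ℤ ⟶ torusChains.X 3, k + l - m = D ≫ torusChains.d 3 2) :
    cycleClass m hm = cycleClass k hk + cycleClass l hl := by
  obtain ⟨D, hD⟩ := h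
  have h0 := torusChains.liftCycles_homologyπ_eq_zero_of_boundary (i := 2) (k + l - m) 1 (by simp) D hD
  have h1 : torusChains.liftCycles (k + l - m) 1 (by simp)
      (by simp [hk, hl, hm, Preadditive.add_comp, Preadditive.sub_comp]) =
      torusChains.liftCycles k 1 (by simp) hk + torusChains.liftCycles l 1 (by simp) hl -
        torusChains.liftCycles m 1 (by simp) hm := by
    rw [← cancel_mono (torusChains.iCycles 2)]
    simp [Preadditive.add_comp, Preadditive.sub_comp]
  rw [h1, Preadditive.sub_comp, Preadditive.add_comp, sub_eq_zero] at h0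
  exact h0.symm

/-- Cut the tall rectangle at integer heights; each unit piece is a lattice translate of the unit
square. -/
theorem cycleClass_rectangleChain (q : ℕ) :
    cycleClass (rectangleChain 0 q) (rectangleChain_d 0 q q (by simp)) =
      q • cycleClass (rectangleChain 0 1) (rectangleChain_d 0 1 1 (by simp)) := by
  have unit : ∀ k : ℕ, cycleClass (rectangleChain k (k + 1 : ℕ)) (rectangleChain_d _ _ 1 (by simp)) =
      cycleClass (rectangleChain 0 1) (rectangleChain_d 0 1 1 (by simp)) := by
    intro k
    congr 1
    rw [rectangleChain, rectangleChain]
    congr 2 <;> refine affineSimplex_translate (0, k) fun i => ?_ <;>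
      fin_cases i <;> simp [add_comm]
  induction q with
  | zero =>
    -- Additivity with all heights `0` says that the class equals its own double, so it vanishes.
    have := cycleClass_add (rectangleChain_d 0 0 0 (by simp)) (rectangleChain_d 0 0 0 (by simp))
      (rectangleChain_d 0 0 0 (by simp)) (rectangleChain_add 0 0 0)
    simpa using this
  | succ k ih =>
    rw [cycleClass_add (rectangleChain_d 0 k k (by simp)) (rectangleChain_d k (k + 1 : ℕ) 1 (by simp))
      (rectangleChain_d 0 _ (k + 1 : ℕ) (by simp)) (rectangleChain_add _ _ _), ih, unit, succ_nsmul]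

/-- The map `(a, b) ↦ (a, b ^ q)` of the torus. -/
def torusPow (q : ℕ) : C(Torus, Torus) where
  toFun y := (y.1, y.2 ^ q)
  continuous_toFun := by fun_prop

/-- The covering lifts to the linear map `(s, t) ↦ (s, q t)` of the plane, which preserves affine
simplices. -/
theorem torusPow_affineSimplex {n : ℕ} (q : ℕ) (v : Fin (n + 1) → ℝ × ℝ) :
    (TopCat.toSSet.map (TopCat.ofHom (torusPow q))).app _ (affineSimplex v) =
      affineSimplex fun i => ((v i).1, q * (v i).2) := by
  have h : (TopCat.toSSet.map (TopCat.ofHom (torusPow q))).app _ (affineSimplex v) =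
      ((TopCat.of Torus).toSSetObjEquiv (.op ⦋n⦌)).symm ((torusPow q).comp (affineMap v)) := rfl
  rw [h, affineSimplex]
  congr 1
  ext x : 1
  change torusPow q (torusCover (∑ i, x.1 i • v i)) =
    torusCover (∑ i, x.1 i • ((v i).1, (q : ℝ) * (v i).2))
  refine Prod.ext ?_ ?_
  · simp [torusPow, torusCover, Prod.fst_sum]
  · simp only [torusPow, torusCover, ContinuousMap.coe_mk, Prod.snd_sum, Prod.smul_snd]
    rw [← Circle.exp_natCast_mul]
    congr 1
    simp only [smul_eq_mul, Finset.mul_sum]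
    exact Finset.sum_congr rfl fun i _ => by ring

theorem torusClass_torusPow (q : ℕ) : torusClass (torusPow q) = (q : ℤ) • fundamentalClass := by
  have hf : fundamentalClass =
      (cycleClass (rectangleChain 0 1) (rectangleChain_d 0 1 1 (by simp))).hom (1 : ℤ) := by
    simp only [fundamentalClass, cycleClass, torusChain_eq_rectangleChain]
    rfl
  -- Already on the level of chains, the unit square goes to the rectangle of height `q`.
  have hmap : rectangleChain 0 1 ≫ (SSet.chainComplexMap
      (TopCat.toSSet.map (TopCat.ofHom (torusPow q))) (ModuleCat.of ℤ ℤ)).f 2 =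
      rectangleChain 0 q := by
    rw [rectangleChain, rectangleChain, Preadditive.sub_comp, SSet.ι_chainComplexMap_f,
      SSet.ι_chainComplexMap_f, torusPow_affineSimplex, torusPow_affineSimplex]
    congr 3 <;> ext i : 1 <;> fin_cases i <;> simp
  have hc : cycleClass (rectangleChain 0 1) (rectangleChain_d 0 1 1 (by simp)) ≫
      ((singularHomologyFunctor (ModuleCat.{0} ℤ) 2).obj (ModuleCat.of ℤ ℤ)).map
        (TopCat.ofHom (torusPow q)) =
      cycleClass (rectangleChain 0 q) (rectangleChain_d 0 q q (by simp)) := by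
    change (_ ≫ _) ≫ HomologicalComplex.homologyMap (SSet.chainComplexMap
      (TopCat.toSSet.map (TopCat.ofHom (torusPow q))) (ModuleCat.of ℤ ℤ)) 2 = _
    rw [Category.assoc, HomologicalComplex.homologyπ_naturality,
      HomologicalComplex.liftCycles_comp_cyclesMap_assoc]
    simp only [hmap, cycleClass]
    rfl
  have h2 := congrArg (fun g => g.hom (1 : ℤ)) (hc.trans (cycleClass_rectangleChain q))
  rw [torusClass, hf]
  refine Eq.trans h2 ?_
  simp

theorem torusClass_comp {X : Type} [TopologicalSpace X] (g : C(Torus, X)) (f : C(Torus, Torus)) :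
    torusClass (g.comp f) = (((singularHomologyFunctor (ModuleCat.{0} ℤ) 2).obj
      (ModuleCat.of ℤ ℤ)).map (TopCat.ofHom g)).hom (torusClass f) := by
  rw [torusClass, TopCat.ofHom_comp, Functor.map_comp]
  rfl

theorem torusClass_comp_torusPow {X : Type} [TopologicalSpace X] (g : C(Torus, X)) (q : ℕ) :
    torusClass (g.comp (torusPow q)) = (q : ℤ) • torusClass g := by
  rw [torusClass_comp, torusClass_torusPow]
  exact map_zsmul (((singularHomologyFunctor (ModuleCat.{0} ℤ) 2).obj
    (ModuleCat.of ℤ ℤ)).map (TopCat.ofHom g)).hom.toAddMonoidHom (q : ℤ) fundamentalClass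

theorem torusClass_eq_of_homotopic {X : Type} [TopologicalSpace X] {f g : C(Torus, X)}
    (h : f.Homotopic g) : torusClass f = torusClass g := by
  obtain ⟨H⟩ := h
  have e := TopCat.Homotopy.congr_homologyMap_singularChainComplexFunctor
    (C := ModuleCat.{0} ℤ) (f := TopCat.ofHom f) (g := TopCat.ofHom g) H (ModuleCat.of ℤ ℤ) 2
  exact congrArg (fun k => k.hom fundamentalClass) e

end Homology


/-! ### The monodromy permutation of the braid -/

section Monodromy

/-- The end position of the strand of the braid of a word which starts at position `j`. -/
def wordPerm : List ℕ → ℕ → ℕ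
  | [], j => j
  | i :: w, j => wordPerm w (Equiv.swap i (i + 1) j)

theorem halfTwist_zero (q i j : ℕ) : halfTwist q i 0 j = slot q j := by
  rw [halfTwist]
  split_ifs with h1 h2
  · subst h1; simp; ring
  · subst h2; simp; ring
  · rfl

theorem halfTwist_one (q i j : ℕ) : halfTwist q i 1 j = slot q (Equiv.swap i (i + 1) j) := by
  rw [halfTwist]
  split_ifs with h1 h2
  · subst h1; simp; ring
  · subst h2; simp; ring
  · rw [Equiv.swap_apply_of_ne_of_ne h1 h2]

theorem wordBraid_zero (q : ℕ) (w : List ℕ) (j : ℕ) : wordBraid q w 0 j = slot q j := by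
  cases w with
  | nil => rfl
  | cons i w => rw [wordBraid, if_pos zero_le_one, halfTwist_zero]

theorem wordBraid_length (q : ℕ) (w : List ℕ) (j : ℕ) :
    wordBraid q w w.length j = slot q (wordPerm w j) := by
  induction w generalizing j with
  | nil => rfl
  | cons i w ih =>
    rw [wordBraid, wordPerm, ← ih]
    split_ifs with h
    -- The first letter covers `t ≤ 1` inclusively, so the final time falls in this branch only when
    -- no letter follows.
    · have hw : w = [] := by
        rw [← List.length_eq_zero_iff]
        rw [List.length_cons] at h
        have : w.length + 1 ≤ 1 := by exact_mod_cast h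
        omega
      subst hw
      simp [halfTwist_one, wordBraid]
    · simp

theorem wordPerm_append (w w' : List ℕ) (j : ℕ) :
    wordPerm (w ++ w') j = wordPerm w' (wordPerm w j) := by
  induction w generalizing j with
  | nil => rfl
  | cons i w ih => exact ih _

theorem wordPerm_replicate_zero (k j : ℕ) :
    wordPerm (List.replicate (2 * k + 1) 0) j = Equiv.swap 0 1 j := by
  induction k with
  | zero => rfl
  | succ k ih =>
    rw [show 2 * (k + 1) + 1 = 2 * k + 1 + 1 + 1 by ring, List.replicate_succ, List.replicate_succ,
      wordPerm, wordPerm, Equiv.swap_apply_self, ih]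

/-- The letters `n, …, 1` act in this order: the last strand is carried down to position `1`, each
strand it passes moves up by one, and position `0` is untouched. -/
theorem wordPerm_descending (n j : ℕ) :
    wordPerm ((List.range n).reverse.map (· + 1)) j =
      if j = 0 then 0 else if j ≤ n then j + 1 else if j = n + 1 then 1 else j := by
  induction n generalizing j with
  | zero => simp only [List.range_zero, List.reverse_nil, List.map_nil, wordPerm]; grind
  | succ n ih =>
    rw [List.range_succ, List.reverse_append, List.reverse_singleton, List.singleton_append,
      List.map_cons, wordPerm, ih, Equiv.swap_apply_def]
    grind

theorem wordPerm_braidWord {p q : ℕ} (hp : 1 ≤ p) (hq : 2 ≤ q) {j : ℕ} (hj : j < q) :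
    wordPerm (braidWord p q) j = (j + 1) % q := by
  obtain ⟨k, rfl⟩ : ∃ k, p = k + 1 := ⟨p - 1, by omega⟩
  obtain ⟨n, rfl⟩ : ∃ n, q = n + 2 := ⟨q - 2, by omega⟩
  rw [braidWord, wordPerm_append, show 2 * (k + 1) - 1 = 2 * k + 1 by omega,
    wordPerm_replicate_zero, Nat.add_sub_cancel, wordPerm_descending, Equiv.swap_apply_def]
  rcases eq_or_ne (j + 1) (n + 2) with h | h
  · rw [h, Nat.mod_self]
    grind
  · rw [Nat.mod_eq_of_lt (by omega)]
    grind

theorem slot_injective {q : ℕ} (hq : 0 < q) : Function.Injective (slot q) := by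
  intro i j h
  have hq' : (q : ℝ) ≠ 0 := by positivity
  have h' := Complex.ofReal_injective h
  field_simp at h'
  have : (i : ℝ) = j := by linarith
  exact_mod_cast this

variable {q : ℕ} (β : ClosedBraid q)

/-- The monodromy of a closure of `B_{p,q}` is a cyclic shift of the `q` strands. -/
theorem ClosedBraid.IsClosureB.exists_perm_iterate {β : ClosedBraid q} {p : ℕ}
    (h : β.IsClosureB p) (hp : 1 ≤ p) (hq : 2 ≤ q) :
    ∃ (τ : Equiv.Perm (Fin q)) (j₀ : Fin q), ∀ m : ℕ, (τ (β.perm^[m] j₀) : ℕ) = m % q := by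
  obtain ⟨h, ρ, τ, -, hinj, hρ, h0, h1⟩ := h
  have mem0 : (0 : ℝ) ∈ Icc (0 : ℝ) 1 := by simp
  have mem1 : (1 : ℝ) ∈ Icc (0 : ℝ) 1 := by simp
  -- One permutation `ρ` serves all stages of the deformation. At stage `0` it is the monodromy of
  -- `β`; at stage `1`, in `hstep`, it is that of the word.
  have hperm : ρ = β.perm := by
    ext1 j
    refine β.injective 0 ?_
    rw [← β.periodic, ← h0 0 mem0, ← hρ 0 mem0, h0 1 mem1, zero_add]
  have hstep : ∀ j, (τ (β.perm j) : ℕ) = (τ j + 1) % q := fun j => by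
    have e := hρ 1 mem1 j
    rw [h1 1 mem1, h1 0 mem0, mul_one, mul_zero, wordBraid_zero, wordBraid_length,
      wordPerm_braidWord hp hq (τ j).2, hperm] at e
    exact (slot_injective (by omega) e).symm
  refine ⟨τ, τ.symm ⟨0, by omega⟩, fun m => ?_⟩
  induction m with
  | zero => simp
  | succ m ih => rw [Function.iterate_succ_apply', hstep, ih, Nat.mod_add_mod]

theorem ClosedBraid.strand_add_nat (t : ℝ) (m : ℕ) (j : Fin q) :
    β.strand (t + m) j = β.strand t (β.perm^[m] j) := by
  induction m generalizing j with
  | zero => simp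
  | succ m ih =>
    rw [Nat.cast_succ, ← add_assoc, β.periodic, ih, Function.iterate_succ_apply]

/-- A `q`-cycle has a single orbit, so the strand `j₀` closes up after `q` turns, not after a number
of turns prime to this period, and passes through every other strand. -/
theorem ClosedBraid.IsClosureB.exists_strand {β : ClosedBraid q} {p : ℕ}
    (h : β.IsClosureB p) (hp : 1 ≤ p) (hq : 2 ≤ q) :
    ∃ j₀ : Fin q, (∀ t, β.strand (t + q) j₀ = β.strand t j₀) ∧
      (∀ (t : ℝ) (m : ℤ), β.strand (t + m) j₀ = β.strand t j₀ → (q : ℤ) ∣ m) ∧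
      ∀ j, ∃ m : ℕ, ∀ t, β.strand t j = β.strand (t + m) j₀ := by
  obtain ⟨τ, j₀, hτ⟩ := h.exists_perm_iterate hp hq
  have hper : ∀ t, β.strand (t + q) j₀ = β.strand t j₀ := fun t => by
    rw [β.strand_add_nat]
    congr 1
    refine τ.injective (Fin.ext ?_)
    rw [hτ, Nat.mod_self]
    simpa using (hτ 0).symm
  have hnat : ∀ (t : ℝ) (m : ℕ), β.strand (t + m) j₀ = β.strand t j₀ → q ∣ m := fun t m e => by
    rw [β.strand_add_nat] at e
    have e' := β.injective t e
    have e0 := hτ 0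
    rw [Function.iterate_zero_apply, ← e', hτ, Nat.zero_mod] at e0
    exact Nat.dvd_of_mod_eq_zero e0
  refine ⟨j₀, hper, fun t m e => ?_, fun j => ⟨τ j, fun t => ?_⟩⟩
  · rcases le_total 0 m with hm | hm
    · lift m to ℕ using hm
      exact_mod_cast hnat t m (by exact_mod_cast e)
    · obtain ⟨k, rfl⟩ : ∃ k : ℕ, m = -k := ⟨(-m).toNat, by omega⟩
      -- A backward shift is a forward shift seen from its earlier endpoint `t - k`.
      have := hnat (t + (-k : ℤ)) k (by rw [e]; congr 1; push_cast; ring)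
      rw [dvd_neg]
      exact_mod_cast this
  · rw [β.strand_add_nat]
    congr 1
    refine τ.injective (Fin.ext ?_)
    rw [hτ, Nat.mod_eq_of_lt (τ j).2]

end Monodromy


/-! ### Angular coordinates on the torus and the area density -/

section TorusCoordinates

open Filter Topology

/-- The universal covering `(s, t) ↦ (exp (i s), exp (i t))` of the torus. -/
def torusExp (x : ℝ × ℝ) : Torus := (Circle.exp x.1, Circle.exp x.2)

theorem torusExp_surjective : Function.Surjective torusExp := fun y =>
  ⟨(Complex.arg y.1, Complex.arg y.2), Prod.ext (Circle.exp_arg _) (Circle.exp_arg _)⟩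

theorem contMDiff_torusExp : ContMDiff 𝓘(ℝ, ℝ × ℝ) torusModel ∞ torusExp :=
  (contMDiff_circleExp.comp contDiff_fst.contMDiff).prodMk
    (contMDiff_circleExp.comp contDiff_snd.contMDiff)

theorem contMDiff_coe_circle : ContMDiff (𝓡 1) 𝓘(ℝ, ℂ) ∞ (fun z : Circle => (z : ℂ)) := by
  have : Fact (Module.finrank ℝ ℂ = 1 + 1) := ⟨Complex.finrank_real_complex⟩
  exact contMDiff_coe_sphere (E := ℂ) (n := 1)

/-- The branch of the angle on the circle with values in `(t - π, t + π]`. -/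
def angleNear (t : ℝ) (z : Circle) : ℝ := t + Complex.arg (z / Circle.exp t : Circle)

theorem exp_angleNear (t : ℝ) (z : Circle) : Circle.exp (angleNear t z) = z := by
  rw [angleNear, Circle.exp_add, Circle.exp_arg, mul_div_cancel]

theorem angleNear_exp {t u : ℝ} (h : |u - t| < Real.pi) : angleNear t (Circle.exp u) = u := by
  rw [angleNear, ← Circle.exp_sub, Circle.arg_exp (abs_lt.1 h).1 (abs_lt.1 h).2.le]
  ring

/-- Dividing by `exp (i t)` moves the point to `1`, where the argument is the imaginary part of a
smooth logarithm. -/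
theorem contMDiffAt_angleNear (t : ℝ) :
    ContMDiffAt (𝓡 1) 𝓘(ℝ, ℝ) ∞ (angleNear t) (Circle.exp t) := by
  have h : ContDiffAt ℝ ∞ (fun w : ℂ => t + (Complex.log (w / (Circle.exp t : ℂ))).im)
      ((Circle.exp t : Circle) : ℂ) := by
    have hne : ((Circle.exp t : Circle) : ℂ) ≠ 0 := Circle.coe_ne_zero _
    have h1 : ContDiffAt ℝ ∞ (fun w : ℂ => Complex.log (w / (Circle.exp t : ℂ)))
        ((Circle.exp t : Circle) : ℂ) := by
      have hlog : ContDiffAt ℝ ∞ Complex.log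
          (((Circle.exp t : Circle) : ℂ) / (Circle.exp t : Circle)) := by
        rw [div_self hne]
        exact (Complex.contDiffAt_log Complex.one_mem_slitPlane).restrict_scalars ℝ
      exact ContDiffAt.comp (g := Complex.log) (f := fun w : ℂ => w / (Circle.exp t : Circle)) _ hlog
        (contDiffAt_id.div_const _)
    exact contDiffAt_const.add (Complex.imCLM.contDiff.contDiffAt.comp _ h1)
  refine (h.contMDiffAt.comp (Circle.exp t) contMDiff_coe_circle.contMDiffAt).congr_of_eventuallyEq ?_
  refine Eventually.of_forall fun z => ?_
  simp only [angleNear, Complex.log_im, Circle.coe_div]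
  rfl

/-- The inverse of the branch of `torusExp` near `x`. -/
def torusAngle (x : ℝ × ℝ) (y : Torus) : ℝ × ℝ := (angleNear x.1 y.1, angleNear x.2 y.2)

theorem torusExp_torusAngle (x : ℝ × ℝ) (y : Torus) : torusExp (torusAngle x y) = y :=
  Prod.ext (exp_angleNear _ _) (exp_angleNear _ _)

theorem torusAngle_torusExp (x : ℝ × ℝ) : ∀ᶠ u in 𝓝 x, torusAngle x (torusExp u) = u := by
  have h1 : ∀ᶠ u in 𝓝 x, |u.1 - x.1| < Real.pi :=
    (isOpen_lt (by fun_prop) continuous_const).mem_nhds (by simp [Real.pi_pos])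
  have h2 : ∀ᶠ u in 𝓝 x, |u.2 - x.2| < Real.pi :=
    (isOpen_lt (by fun_prop) continuous_const).mem_nhds (by simp [Real.pi_pos])
  filter_upwards [h1, h2] with u hu1 hu2
  exact Prod.ext (angleNear_exp hu1) (angleNear_exp hu2)

theorem torusAngle_torusExp_self (x : ℝ × ℝ) : torusAngle x (torusExp x) = x :=
  (torusAngle_torusExp x).self_of_nhds

theorem contMDiffAt_torusAngle (x : ℝ × ℝ) :
    ContMDiffAt torusModel 𝓘(ℝ, ℝ × ℝ) ∞ (torusAngle x) (torusExp x) :=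
  ((contMDiffAt_angleNear x.1).comp (torusExp x) contMDiffAt_fst).prodMk_space
    ((contMDiffAt_angleNear x.2).comp (torusExp x) contMDiffAt_snd)

theorem mdifferentiableAt_torusExp (x : ℝ × ℝ) :
    MDifferentiableAt 𝓘(ℝ, ℝ × ℝ) torusModel torusExp x :=
  contMDiff_torusExp.mdifferentiable (by simp) x

/-- Differentiate the two identities expressing that `torusAngle x` inverts `torusExp` near `x`. -/
theorem mfderiv_torusExp_bijective (x : ℝ × ℝ) :
    Function.Bijective (mfderiv 𝓘(ℝ, ℝ × ℝ) torusModel torusExp x) := by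
  have hL : MDifferentiableAt torusModel 𝓘(ℝ, ℝ × ℝ) (torusAngle x) (torusExp x) :=
    (contMDiffAt_torusAngle x).mdifferentiableAt (by simp)
  have hE := mdifferentiableAt_torusExp x
  constructor
  · have h1 : mfderiv 𝓘(ℝ, ℝ × ℝ) 𝓘(ℝ, ℝ × ℝ) (torusAngle x ∘ torusExp) x =
        mfderiv 𝓘(ℝ, ℝ × ℝ) 𝓘(ℝ, ℝ × ℝ) (id : ℝ × ℝ → ℝ × ℝ) x :=
      Filter.EventuallyEq.mfderiv_eq (torusAngle_torusExp x)
    rw [mfderiv_comp x hL hE, mfderiv_id] at h1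
    exact Function.LeftInverse.injective (g := mfderiv torusModel 𝓘(ℝ, ℝ × ℝ) (torusAngle x) (torusExp x))
      fun v => DFunLike.congr_fun h1 v
  · have h2 : mfderiv torusModel torusModel (torusExp ∘ torusAngle x) (torusExp x) =
        mfderiv torusModel torusModel (id : Torus → Torus) (torusExp x) :=
      mfderiv_congr (funext (torusExp_torusAngle x))
    have hE' : HasMFDerivAt 𝓘(ℝ, ℝ × ℝ) torusModel torusExp (torusAngle x (torusExp x))
        (mfderiv 𝓘(ℝ, ℝ × ℝ) torusModel torusExp x) := by
      rw [torusAngle_torusExp_self]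
      exact hE.hasMFDerivAt
    rw [(hE'.comp (torusExp x) hL.hasMFDerivAt).mfderiv, mfderiv_id] at h2
    intro v
    exact ⟨_, DFunLike.congr_fun h2 v⟩

section

variable {X : Type} [TopologicalSpace X] [ChartedSpace E4 X] {f : Torus → X}

theorem mfderiv_comp_torusExp (hf : ContMDiff torusModel (𝓡 4) ∞ f) (x v : ℝ × ℝ) :
    mfderiv 𝓘(ℝ, ℝ × ℝ) (𝓡 4) (f ∘ torusExp) x v =
      mfderiv torusModel (𝓡 4) f (torusExp x) (mfderiv 𝓘(ℝ, ℝ × ℝ) torusModel torusExp x v) := by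
  rw [mfderiv_comp x (hf.mdifferentiable (by simp) _) (mdifferentiableAt_torusExp x)]
  rfl

theorem injective_mfderiv_of_comp_torusExp (hf : ContMDiff torusModel (𝓡 4) ∞ f)
    (h : ∀ x, Function.Injective (mfderiv 𝓘(ℝ, ℝ × ℝ) (𝓡 4) (f ∘ torusExp) x)) (y : Torus) :
    Function.Injective (mfderiv torusModel (𝓡 4) f y) := by
  obtain ⟨x, rfl⟩ := torusExp_surjective y
  intro v w hvw
  obtain ⟨v, rfl⟩ := (mfderiv_torusExp_bijective x).2 v
  obtain ⟨w, rfl⟩ := (mfderiv_torusExp_bijective x).2 w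
  congr 1
  exact h x ((mfderiv_comp_torusExp hf x v).trans (hvw.trans (mfderiv_comp_torusExp hf x w).symm))

theorem areaDensity_eq (Ω : TwoForm X) (hf : ContMDiff torusModel (𝓡 4) ∞ f) (s t : ℝ) :
    areaDensity Ω f s t = Ω (f (torusExp (s, t)))
      ![mfderiv 𝓘(ℝ, ℝ × ℝ) (𝓡 4) (f ∘ torusExp) (s, t) (1, 0),
        mfderiv 𝓘(ℝ, ℝ × ℝ) (𝓡 4) (f ∘ torusExp) (s, t) (0, 1)] := by
  have hd : MDifferentiableAt 𝓘(ℝ, ℝ × ℝ) (𝓡 4) (f ∘ torusExp) (s, t) :=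
    (hf.comp contMDiff_torusExp).mdifferentiable (by simp) _
  have h1 : HasMFDerivAt 𝓘(ℝ, ℝ) 𝓘(ℝ, ℝ × ℝ) (fun u : ℝ => (u, t)) s
      ((ContinuousLinearMap.id ℝ ℝ).prod 0) :=
    ((hasFDerivAt_id s).prodMk (hasFDerivAt_const t s)).hasMFDerivAt
  have h2 : HasMFDerivAt 𝓘(ℝ, ℝ) 𝓘(ℝ, ℝ × ℝ) (fun u : ℝ => (s, u)) t
      (ContinuousLinearMap.prod 0 (ContinuousLinearMap.id ℝ ℝ)) :=
    ((hasFDerivAt_const s t).prodMk (hasFDerivAt_id t)).hasMFDerivAt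
  have e1 : mfderiv 𝓘(ℝ, ℝ) (𝓡 4) (fun u : ℝ => f (Circle.exp u, Circle.exp t)) s (1 : ℝ) =
      mfderiv 𝓘(ℝ, ℝ × ℝ) (𝓡 4) (f ∘ torusExp) (s, t) (1, 0) :=
    DFunLike.congr_fun (HasMFDerivAt.comp s hd.hasMFDerivAt h1).mfderiv (1 : ℝ)
  have e2 : mfderiv 𝓘(ℝ, ℝ) (𝓡 4) (fun u : ℝ => f (Circle.exp s, Circle.exp u)) t (1 : ℝ) =
      mfderiv 𝓘(ℝ, ℝ × ℝ) (𝓡 4) (f ∘ torusExp) (s, t) (0, 1) :=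
    DFunLike.congr_fun (HasMFDerivAt.comp t hd.hasMFDerivAt h2).mfderiv (1 : ℝ)
  rw [areaDensity, e1, e2]
  rfl

/-- An alternating 2-form on vectors expanded in a frame. -/
theorem alternating_frame {V : Type*} [AddCommGroup V] [Module ℝ V] [TopologicalSpace V]
    (η : V [⋀^Fin 2]→L[ℝ] ℝ) (a b : V) (c d c' d' : ℝ) :
    η ![c • a + d • b, c' • a + d' • b] = (c * d' - d * c') * η ![a, b] := by
  have upd : ∀ u w z : V, Function.update ![u, w] 0 z = ![z, w] := fun u w z => by
    ext i : 1; fin_cases i <;> rfl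
  have add_left : ∀ u v w, η ![u + v, w] = η ![u, w] + η ![v, w] := fun u v w => by
    have := η.map_update_add ![u, w] 0 u v
    rwa [upd, upd, upd] at this
  have smul_left : ∀ (r : ℝ) u w, η ![r • u, w] = r * η ![u, w] := fun r u w => by
    have := η.map_update_smul ![u, w] 0 r u
    rwa [upd, upd] at this
  have swap : ∀ u v, η ![u, v] = -η ![v, u] := fun u v => by
    have := η.toAlternatingMap.map_swap ![v, u] (i := 0) (j := 1) (by decide)
    have e : ![v, u] ∘ Equiv.swap (0 : Fin 2) 1 = ![u, v] := by
      ext i : 1; fin_cases i <;> rfl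
    rw [e] at this
    exact this
  have self : ∀ u, η ![u, u] = 0 := fun u => by linarith [swap u u]
  rw [add_left, smul_left, smul_left, swap a, swap b, add_left, add_left, smul_left, smul_left,
    smul_left, smul_left, self, self, swap b a]
  ring

theorem form_mfderiv_torusExp (Ω : TwoForm X) (hf : ContMDiff torusModel (𝓡 4) ∞ f) (s t : ℝ)
    (v w : ℝ × ℝ) :
    Ω (f (torusExp (s, t))) ![mfderiv torusModel (𝓡 4) f (torusExp (s, t))
        (mfderiv 𝓘(ℝ, ℝ × ℝ) torusModel torusExp (s, t) v),
      mfderiv torusModel (𝓡 4) f (torusExp (s, t))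
        (mfderiv 𝓘(ℝ, ℝ × ℝ) torusModel torusExp (s, t) w)] =
      (v.1 * w.2 - v.2 * w.1) * areaDensity Ω f s t := by
  have h : ∀ v : ℝ × ℝ, mfderiv 𝓘(ℝ, ℝ × ℝ) (𝓡 4) (f ∘ torusExp) (s, t) v =
      v.1 • mfderiv 𝓘(ℝ, ℝ × ℝ) (𝓡 4) (f ∘ torusExp) (s, t) (1, 0) +
        v.2 • mfderiv 𝓘(ℝ, ℝ × ℝ) (𝓡 4) (f ∘ torusExp) (s, t) (0, 1) := fun v => by
    have hv : v = v.1 • ((1 : ℝ), (0 : ℝ)) + v.2 • ((0 : ℝ), (1 : ℝ)) := by ext <;> simp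
    calc _ = mfderiv 𝓘(ℝ, ℝ × ℝ) (𝓡 4) (f ∘ torusExp) (s, t)
          (v.1 • ((1 : ℝ), (0 : ℝ)) + v.2 • ((0 : ℝ), (1 : ℝ))) := by rw [← hv]
      _ = _ := by
        refine ((mfderiv 𝓘(ℝ, ℝ × ℝ) (𝓡 4) (f ∘ torusExp) (s, t)).map_add _ _).trans ?_
        congr 1 <;> exact (mfderiv 𝓘(ℝ, ℝ × ℝ) (𝓡 4) (f ∘ torusExp) (s, t)).map_smul _ _
  rw [← mfderiv_comp_torusExp hf, ← mfderiv_comp_torusExp hf, h v, h w, areaDensity_eq Ω hf]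
  exact alternating_frame (V := E4) (Ω (f (torusExp (s, t)))) _ _ _ _ _ _

/-- An alternating form on a plane is determined by its value on one frame, so nondegeneracy is the
nonvanishing of a single function. -/
theorem isSymplecticMap_iff (Ω : TwoForm X) (hf : ContMDiff torusModel (𝓡 4) ∞ f) :
    IsSymplecticMap Ω f ↔ ∀ s t, areaDensity Ω f s t ≠ 0 := by
  constructor
  · intro h s t h0
    have hne : mfderiv 𝓘(ℝ, ℝ × ℝ) torusModel torusExp (s, t) ((1 : ℝ), (0 : ℝ)) ≠ 0 := by
      intro h0
      have := (mfderiv_torusExp_bijective (s, t)).1 (h0.trans (map_zero _).symm)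
      exact one_ne_zero (congrArg Prod.fst this : (1 : ℝ) = 0)
    obtain ⟨w, hw⟩ := h _ _ hne
    obtain ⟨w, rfl⟩ := (mfderiv_torusExp_bijective (s, t)).2 w
    refine hw ((form_mfderiv_torusExp Ω hf s t (1, 0) w).trans ?_)
    rw [h0, mul_zero]
  · intro h y v hv
    obtain ⟨⟨s, t⟩, rfl⟩ := torusExp_surjective y
    obtain ⟨v, rfl⟩ := (mfderiv_torusExp_bijective (s, t)).2 v
    change ℝ × ℝ at v
    have hv0 : v ≠ 0 := by
      rintro rfl
      exact hv (map_zero _)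
    -- The partner of `v` is its quarter turn, for which the determinant is `|v|²`.
    refine ⟨mfderiv 𝓘(ℝ, ℝ × ℝ) torusModel torusExp (s, t) (-v.2, v.1), ?_⟩
    intro h0
    have := (form_mfderiv_torusExp Ω hf s t v (-v.2, v.1)).symm.trans h0
    have hsq : v.1 * v.1 - v.2 * -v.2 = 0 := by
      simpa [h s t] using this
    refine hv0 (Prod.ext ?_ ?_)
    · simp only [Prod.fst_zero]; nlinarith [sq_nonneg v.1, sq_nonneg v.2]
    · simp only [Prod.snd_zero]; nlinarith [sq_nonneg v.1, sq_nonneg v.2]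

end

end TorusCoordinates


/-! ### Pulling the form back to the universal covering of the neighbourhood -/

section FramedCoordinates

open Filter Topology

/-- The coordinates `((s, t), z)` on the universal covering of a framed neighbourhood. -/
abbrev Coord : Type := (ℝ × ℝ) × ℂ

/-- The domain `ℝ² × D²` of the universal covering of a framed neighbourhood. -/
def solid : Set Coord := {p | ‖p.2‖ < 1}

theorem isOpen_solid : IsOpen solid := isOpen_lt (by fun_prop) continuous_const

theorem isPreconnected_solid : IsPreconnected solid := by
  have : solid = (univ : Set (ℝ × ℝ)) ×ˢ Metric.ball (0 : ℂ) 1 := by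
    ext p; simp [solid]
  rw [this]
  exact (convex_univ.prod (convex_ball _ _)).isPreconnected

theorem continuous_pairing :
    Continuous fun x : (E4 [⋀^Fin 2]→L[ℝ] ℝ) × E4 × E4 => x.1 ![x.2.1, x.2.2] := by
  have h1 : Continuous fun x : (E4 [⋀^Fin 2]→L[ℝ] ℝ) × E4 × E4 =>
      x.1.toContinuousMultilinearMap :=
    (ContinuousAlternatingMap.isEmbedding_toContinuousMultilinearMap.continuous).comp continuous_fst
  have h2 : Continuous fun x : (E4 [⋀^Fin 2]→L[ℝ] ℝ) × E4 × E4 => ![x.2.1, x.2.2] := by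
    fun_prop
  exact h1.eval h2

namespace FramedNeighbourhood

variable {X : Type} [TopologicalSpace X] [ChartedSpace E4 X] (Φ : FramedNeighbourhood X)

/-- The universal covering of a framed neighbourhood. -/
def cover (p : Coord) : X := Φ.point (torusExp p.1) p.2

theorem contMDiffOn_cover : ContMDiffOn 𝓘(ℝ, Coord) (𝓡 4) ∞ Φ.cover solid := by
  have h : ContMDiff 𝓘(ℝ, Coord) (torusModel.prod 𝓘(ℝ, ℂ)) ∞
      (fun p : Coord => (torusExp p.1, p.2)) :=
    (contMDiff_torusExp.comp contDiff_fst.contMDiff).prodMk contDiff_snd.contMDiff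
  refine Φ.contMDiffOn.comp h.contMDiffOn fun p hp => ?_
  rw [mem_preimage, Φ.source_eq]
  exact hp

theorem mdifferentiableAt_cover {p : Coord} (hp : p ∈ solid) :
    MDifferentiableAt 𝓘(ℝ, Coord) (𝓡 4) Φ.cover p :=
  (Φ.contMDiffOn_cover.contMDiffAt (isOpen_solid.mem_nhds hp)).mdifferentiableAt (by simp)

/-- A local inverse `G` is the inverse framing followed by a branch of the two angles. -/
theorem mfderiv_cover_bijective {p : Coord} (hp : p ∈ solid) :
    Function.Bijective (mfderiv 𝓘(ℝ, Coord) (𝓡 4) Φ.cover p) := by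
  let P := Φ.toOpenPartialHomeomorph
  have hsrc : ∀ u ∈ solid, (torusExp u.1, u.2) ∈ P.source := fun u hu => by
    rw [Φ.source_eq]; exact hu
  have htgt : Φ.cover p ∈ P.target := P.map_source (hsrc p hp)
  have hback : ∀ u ∈ solid, P.symm (Φ.cover u) = (torusExp u.1, u.2) := fun u hu =>
    P.left_inv (hsrc u hu)
  let G : X → Coord := fun x => (torusAngle p.1 (P.symm x).1, (P.symm x).2)
  have hPs : ContMDiffAt (𝓡 4) (torusModel.prod 𝓘(ℝ, ℂ)) ∞ P.symm (Φ.cover p) :=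
    Φ.contMDiffOn_symm.contMDiffAt (P.open_target.mem_nhds htgt)
  have hG : MDifferentiableAt (𝓡 4) 𝓘(ℝ, Coord) G (Φ.cover p) := by
    have h1 : ContMDiffAt torusModel 𝓘(ℝ, ℝ × ℝ) ∞ (torusAngle p.1) (P.symm (Φ.cover p)).1 := by
      rw [hback p hp]; exact contMDiffAt_torusAngle p.1
    exact ((h1.comp (Φ.cover p) hPs.fst).prodMk_space hPs.snd).mdifferentiableAt (by simp)
  have hE := Φ.mdifferentiableAt_cover hp
  have hGp : G (Φ.cover p) = p := by
    simp only [G]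
    rw [hback p hp, torusAngle_torusExp_self]
  constructor
  · have hleft : G ∘ Φ.cover =ᶠ[𝓝 p] id := by
      filter_upwards [isOpen_solid.mem_nhds hp,
        (continuous_fst.tendsto p).eventually (torusAngle_torusExp p.1)] with u hu hu'
      simp only [G, Function.comp_apply, id]
      rw [hback u hu, hu']
    have h1 := Filter.EventuallyEq.mfderiv_eq (I := 𝓘(ℝ, Coord)) (I' := 𝓘(ℝ, Coord)) hleft
    rw [mfderiv_comp p hG hE, mfderiv_id] at h1
    exact Function.LeftInverse.injective (g := mfderiv (𝓡 4) 𝓘(ℝ, Coord) G (Φ.cover p))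
      fun v => DFunLike.congr_fun h1 v
  · have hright : Φ.cover ∘ G =ᶠ[𝓝 (Φ.cover p)] id := by
      filter_upwards [P.open_target.mem_nhds htgt] with x hx
      simp only [G, Function.comp_apply, id, cover, torusExp_torusAngle]
      exact P.right_inv hx
    have h2 := Filter.EventuallyEq.mfderiv_eq (I := 𝓡 4) (I' := 𝓡 4) hright
    have hE' : HasMFDerivAt 𝓘(ℝ, Coord) (𝓡 4) Φ.cover (G (Φ.cover p))
        (mfderiv 𝓘(ℝ, Coord) (𝓡 4) Φ.cover p) := by
      rw [hGp]
      exact hE.hasMFDerivAt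
    rw [(hE'.comp (Φ.cover p) hG.hasMFDerivAt).mfderiv, mfderiv_id] at h2
    intro v
    exact ⟨_, DFunLike.congr_fun h2 v⟩

/-- The pull-back of a 2-form to the universal covering of a framed neighbourhood. -/
def pullback (Ω : TwoForm X) (p u v : Coord) : ℝ :=
  Ω (Φ.cover p) ![mfderiv 𝓘(ℝ, Coord) (𝓡 4) Φ.cover p u, mfderiv 𝓘(ℝ, Coord) (𝓡 4) Φ.cover p v]

theorem pullback_nondegenerate {Ω : TwoForm X} (hΩ : IsSymplecticForm Ω) {p u : Coord}
    (hp : p ∈ solid) (hu : u ≠ 0) : ∃ v, Φ.pullback Ω p u v ≠ 0 := by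
  have hb := Φ.mfderiv_cover_bijective hp
  obtain ⟨w, hw⟩ := hΩ.nondegenerate (Φ.cover p) (mfderiv 𝓘(ℝ, Coord) (𝓡 4) Φ.cover p u)
    fun h => hu (hb.1 (h.trans (map_zero _).symm))
  obtain ⟨v, rfl⟩ := hb.2 w
  exact ⟨v, hw⟩

theorem pullback_add_right (Ω : TwoForm X) (p u v w : Coord) :
    Φ.pullback Ω p u (v + w) = Φ.pullback Ω p u v + Φ.pullback Ω p u w := by
  let D : Coord →L[ℝ] E4 := mfderiv 𝓘(ℝ, Coord) (𝓡 4) Φ.cover p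
  let η : E4 [⋀^Fin 2]→L[ℝ] ℝ := Ω (Φ.cover p)
  change η ![D u, D (v + w)] = η ![D u, D v] + η ![D u, D w]
  have upd : ∀ z, Function.update ![D u, D v] 1 z = ![D u, z] := fun z => by
    ext i : 1; fin_cases i <;> rfl
  have := η.map_update_add ![D u, D v] 1 (D v) (D w)
  rw [upd, upd, upd] at this
  rw [map_add, this]

theorem pullback_smul_right (Ω : TwoForm X) (p u v : Coord) (r : ℝ) :
    Φ.pullback Ω p u (r • v) = r * Φ.pullback Ω p u v := by
  let D : Coord →L[ℝ] E4 := mfderiv 𝓘(ℝ, Coord) (𝓡 4) Φ.cover p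
  let η : E4 [⋀^Fin 2]→L[ℝ] ℝ := Ω (Φ.cover p)
  change η ![D u, D (r • v)] = r * η ![D u, D v]
  have upd : ∀ z, Function.update ![D u, D v] 1 z = ![D u, z] := fun z => by
    ext i : 1; fin_cases i <;> rfl
  have := η.map_update_smul ![D u, D v] 1 r (D v)
  rw [upd, upd] at this
  rw [map_smul, this, smul_eq_mul]

theorem pullback_self (Ω : TwoForm X) (p u : Coord) : Φ.pullback Ω p u u = 0 :=
  (Ω (Φ.cover p)).map_eq_zero_of_eq _ (i := 0) (j := 1) rfl (by decide)

/-- Smoothness of `Ω` is given in charts of the atlas, so the covering is factored locally through a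
chart; there the form and the derivative both vary continuously. -/
theorem continuousOn_pullback [IsManifold (𝓡 4) ∞ X] {Ω : TwoForm X} (hΩ : IsSymplecticForm Ω) :
    ContinuousOn (fun x : Coord × Coord × Coord => Φ.pullback Ω x.1 x.2.1 x.2.2)
      (solid ×ˢ univ) := by
  rintro ⟨p₀, u₀, v₀⟩ ⟨hp₀ : p₀ ∈ solid, -⟩
  refine ContinuousAt.continuousWithinAt ?_
  let e := chartAt E4 (Φ.cover p₀)
  have he : e ∈ atlas E4 X := chart_mem_atlas _ _
  let U : Set Coord := solid ∩ Φ.cover ⁻¹' e.source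
  have hU : IsOpen U := Φ.contMDiffOn_cover.continuousOn.isOpen_inter_preimage isOpen_solid e.open_source
  have hp₀U : p₀ ∈ U := ⟨hp₀, mem_chart_source _ _⟩
  have hcd : ContDiffOn ℝ ∞ (e ∘ Φ.cover) U := by
    rw [← contMDiffOn_iff_contDiffOn]
    exact (contMDiffOn_chart (I := 𝓡 4)).comp (Φ.contMDiffOn_cover.mono inter_subset_left)
      inter_subset_right
  have hfd : ContinuousOn (fderiv ℝ (e ∘ Φ.cover)) U :=
    hcd.continuousOn_fderiv_of_isOpen hU (by simp)
  have hform : ContinuousOn (fun p => Ω.inChart e (e (Φ.cover p))) U :=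
    (hΩ.smooth e he).continuousOn.comp hcd.continuousOn fun p hp => e.map_source hp.2
  have hval : ∀ p ∈ U, ∀ u v, Φ.pullback Ω p u v = Ω.inChart e (e (Φ.cover p))
      ![fderiv ℝ (e ∘ Φ.cover) p u, fderiv ℝ (e ∘ Φ.cover) p v] := by
    intro p hp u v
    have h1 : HasMFDerivAt 𝓘(ℝ, Coord) 𝓘(ℝ, E4) (e ∘ Φ.cover) p (fderiv ℝ (e ∘ Φ.cover) p) :=
      ((hcd.contDiffAt (hU.mem_nhds hp)).differentiableAt (by simp)).hasFDerivAt.hasMFDerivAt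
    have h2 : MDifferentiableAt 𝓘(ℝ, E4) (𝓡 4) e.symm (e (Φ.cover p)) :=
      ((contMDiffOn_chart_symm (I := 𝓡 4) (n := ∞) (x := Φ.cover p₀)).contMDiffAt
        (e.open_target.mem_nhds (e.map_source hp.2))).mdifferentiableAt (by simp)
    have h3 : Φ.cover =ᶠ[𝓝 p] e.symm ∘ e ∘ Φ.cover := by
      filter_upwards [hU.mem_nhds hp] with x hx
      exact (e.left_inv hx.2).symm
    have h4 : mfderiv 𝓘(ℝ, Coord) (𝓡 4) Φ.cover p =
        (mfderiv 𝓘(ℝ, E4) (𝓡 4) e.symm (e (Φ.cover p)) : E4 →L[ℝ] E4).comp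
          (fderiv ℝ (e ∘ Φ.cover) p) :=
      h3.mfderiv_eq.trans (h2.hasMFDerivAt.comp p h1).mfderiv
    -- Every tangent space is the model `E4`; forgetting the dependence on the point lets the base
    -- point be rewritten.
    let Ω' : X → E4 [⋀^Fin 2]→L[ℝ] ℝ := Ω
    have h5 : Ω' (Φ.cover p) = Ω' (e.symm (e (Φ.cover p))) := by rw [e.left_inv hp.2]
    change Ω' (Φ.cover p) ![(mfderiv 𝓘(ℝ, Coord) (𝓡 4) Φ.cover p : Coord →L[ℝ] E4) u,
      (mfderiv 𝓘(ℝ, Coord) (𝓡 4) Φ.cover p : Coord →L[ℝ] E4) v] = _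
    rw [h5, h4]
    refine congrArg (Ω' (e.symm (e (Φ.cover p)))) ?_
    ext i : 1
    fin_cases i <;> rfl
  have hcont : ContinuousAt (fun x : Coord × Coord × Coord => Ω.inChart e (e (Φ.cover x.1))
      ![fderiv ℝ (e ∘ Φ.cover) x.1 x.2.1, fderiv ℝ (e ∘ Φ.cover) x.1 x.2.2]) (p₀, u₀, v₀) := by
    have c1 : ContinuousAt (fun x : Coord × Coord × Coord => Ω.inChart e (e (Φ.cover x.1)))
        (p₀, u₀, v₀) := (hform.continuousAt (hU.mem_nhds hp₀U)).comp_of_eq continuousAt_fst rfl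
    have c2 : ContinuousAt (fun x : Coord × Coord × Coord => fderiv ℝ (e ∘ Φ.cover) x.1)
        (p₀, u₀, v₀) := (hfd.continuousAt (hU.mem_nhds hp₀U)).comp_of_eq continuousAt_fst rfl
    exact continuous_pairing.continuousAt.comp (c1.prodMk
      ((c2.clm_apply (by fun_prop)).prodMk (c2.clm_apply (by fun_prop))))
  refine hcont.congr ?_
  filter_upwards [continuousAt_fst.eventually (hU.mem_nhds hp₀U)] with x hx
  exact (hval x.1 hx _ _).symm

end FramedNeighbourhood

end FramedCoordinates


/-! ### Multisections: embedding, area density, homology class -/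

section Multisections

open Filter Topology

/-- The coordinate vector field `∂/∂s`. -/
def dirS : Coord := ((1, 0), 0)

/-- The coordinate vector field `∂/∂t`. -/
def dirT : Coord := ((0, 1), 0)

namespace FramedNeighbourhood

variable {X : Type} [TopologicalSpace X] [ChartedSpace E4 X] (Φ : FramedNeighbourhood X)

/-- The multisection `(a, b) ↦ ((a, b ^ q), w b)` of the framed neighbourhood. -/
def multisection (q : ℕ) (w : Circle → ℂ) (y : Torus) : X := Φ.point (y.1, y.2 ^ q) (w y.2)

theorem contMDiffOn_point : ContMDiffOn (torusModel.prod 𝓘(ℝ, ℂ)) (𝓡 4) ∞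
    (fun x : Torus × ℂ => Φ.point x.1 x.2) {x | ‖x.2‖ < 1} := by
  rw [← Φ.source_eq]
  exact Φ.contMDiffOn

theorem point_injective {y y' : Torus} {z z' : ℂ} (hz : ‖z‖ < 1) (hz' : ‖z'‖ < 1)
    (h : Φ.point y z = Φ.point y' z') : y = y' ∧ z = z' := by
  have := Φ.toOpenPartialHomeomorph.injOn (x₁ := (y, z)) (x₂ := (y', z'))
    (by rw [Φ.source_eq]; exact hz) (by rw [Φ.source_eq]; exact hz') h
  exact Prod.ext_iff.1 this

section Smooth

variable {q : ℕ} {w : Circle → ℂ}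

theorem contMDiff_multisection (hw : ContMDiff (𝓡 1) 𝓘(ℝ, ℂ) ∞ w) (hw1 : ∀ b, ‖w b‖ < 1) :
    ContMDiff torusModel (𝓡 4) ∞ (Φ.multisection q w) := by
  have hpow : ContMDiff torusModel (𝓡 1) ∞ (fun y : Torus => y.2 ^ q) := by
    have : LieGroup (𝓡 1) ∞ Circle := LieGroup.of_le (n := ω) le_top
    exact contMDiff_snd.pow q
  have h : ContMDiff torusModel (torusModel.prod 𝓘(ℝ, ℂ)) ∞
      (fun y : Torus => (((y.1, y.2 ^ q) : Torus), w y.2)) :=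
    (contMDiff_fst.prodMk hpow).prodMk (hw.comp contMDiff_snd)
  exact Φ.contMDiffOn_point.comp_contMDiff h fun y => hw1 y.2

theorem multisection_comp_torusExp : Φ.multisection q w ∘ torusExp =
    fun x => Φ.cover ((x.1, q * x.2), w (Circle.exp x.2)) := by
  ext x
  simp [multisection, cover, torusExp, Circle.exp_natCast_mul]

theorem mfderiv_multisection_comp_torusExp (hw : ContMDiff (𝓡 1) 𝓘(ℝ, ℂ) ∞ w)
    (hw1 : ∀ b, ‖w b‖ < 1) (s t : ℝ) (v : ℝ × ℝ) :
    mfderiv 𝓘(ℝ, ℝ × ℝ) (𝓡 4) (Φ.multisection q w ∘ torusExp) (s, t) v =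
      mfderiv 𝓘(ℝ, Coord) (𝓡 4) Φ.cover ((s, q * t), w (Circle.exp t))
        ((v.1, q * v.2), v.2 • deriv (fun u => w (Circle.exp u)) t) := by
  have hz : HasDerivAt (fun u => w (Circle.exp u)) (deriv (fun u => w (Circle.exp u)) t) t := by
    have : ContDiff ℝ ∞ (fun u => w (Circle.exp u)) :=
      (hw.comp contMDiff_circleExp).contDiff
    exact (this.differentiable (by simp) t).hasDerivAt
  have hγ : HasFDerivAt (fun x : ℝ × ℝ => (((x.1, q * x.2), w (Circle.exp x.2)) : Coord))
      (((ContinuousLinearMap.fst ℝ ℝ ℝ).prod ((q : ℝ) • ContinuousLinearMap.snd ℝ ℝ ℝ)).prod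
        (((ContinuousLinearMap.id ℝ ℝ).smulRight (deriv (fun u => w (Circle.exp u)) t)).comp
          (ContinuousLinearMap.snd ℝ ℝ ℝ))) (s, t) := by
    refine (hasFDerivAt_fst.prodMk (hasFDerivAt_snd.const_smul (q : ℝ))).prodMk ?_
    exact HasFDerivAt.comp (s, t) (g := fun u => w (Circle.exp u)) hz.hasFDerivAt hasFDerivAt_snd
  have hp : ((s, q * t), w (Circle.exp t)) ∈ solid := hw1 _
  rw [multisection_comp_torusExp]
  exact DFunLike.congr_fun
    (HasMFDerivAt.comp (s, t) (Φ.mdifferentiableAt_cover hp).hasMFDerivAt hγ.hasMFDerivAt).mfderiv v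

/-- Since `w` depends only on `b`, the frame is sent to `∂/∂s` and `q ∂/∂t + w'`. Only the cross
term with `w'` can spoil the sign of the slice term. -/
theorem areaDensity_multisection (Ω : TwoForm X) (hw : ContMDiff (𝓡 1) 𝓘(ℝ, ℂ) ∞ w)
    (hw1 : ∀ b, ‖w b‖ < 1) (s t : ℝ) :
    areaDensity Ω (Φ.multisection q w) s t =
      q * Φ.pullback Ω ((s, q * t), w (Circle.exp t)) dirS dirT +
        Φ.pullback Ω ((s, q * t), w (Circle.exp t)) dirS
          (0, deriv (fun u => w (Circle.exp u)) t) := by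
  have h : areaDensity Ω (Φ.multisection q w) s t =
      Φ.pullback Ω ((s, q * t), w (Circle.exp t)) dirS
        ((0, q), deriv (fun u => w (Circle.exp u)) t) := by
    let Ω' : X → E4 [⋀^Fin 2]→L[ℝ] ℝ := Ω
    have hbase : Φ.multisection q w (torusExp (s, t)) =
        Φ.cover ((s, q * t), w (Circle.exp t)) := congrFun Φ.multisection_comp_torusExp (s, t)
    rw [areaDensity_eq Ω (Φ.contMDiff_multisection hw hw1),
      Φ.mfderiv_multisection_comp_torusExp hw hw1, Φ.mfderiv_multisection_comp_torusExp hw hw1]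
    simp only [mul_zero, mul_one, zero_smul, one_smul]
    exact congrArg (fun x => Ω' x ![(mfderiv 𝓘(ℝ, Coord) (𝓡 4) Φ.cover
      ((s, q * t), w (Circle.exp t)) : Coord →L[ℝ] E4) dirS, (mfderiv 𝓘(ℝ, Coord) (𝓡 4) Φ.cover
      ((s, q * t), w (Circle.exp t)) : Coord →L[ℝ] E4)
        ((0, q), deriv (fun u => w (Circle.exp u)) t)]) hbase
  rw [h, ← pullback_smul_right, ← pullback_add_right]
  congr 1
  simp [dirT]

theorem isSmoothTorus_multisection [T2Space X] (hq : q ≠ 0) (hw : ContMDiff (𝓡 1) 𝓘(ℝ, ℂ) ∞ w)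
    (hw1 : ∀ b, ‖w b‖ < 1) (hinj : ∀ b b', b ^ q = b' ^ q → w b = w b' → b = b') :
    IsSmoothTorus (Φ.multisection q w) where
  contMDiff := Φ.contMDiff_multisection hw hw1
  immersion := by
    refine injective_mfderiv_of_comp_torusExp (Φ.contMDiff_multisection hw hw1) ?_
    rintro ⟨s, t⟩ v v' h
    have h' := (Φ.mfderiv_multisection_comp_torusExp hw hw1 s t v).symm.trans
      (h.trans (Φ.mfderiv_multisection_comp_torusExp hw hw1 s t v'))
    have hp : ((s, q * t), w (Circle.exp t)) ∈ solid := hw1 _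
    change ℝ × ℝ at v v'
    -- The torus component `(1, q)` of the derivative is already injective, whatever `w` does.
    have h2 : ((v.1, q * v.2) : ℝ × ℝ) = (v'.1, q * v'.2) := congrArg Prod.fst ((Φ.mfderiv_cover_bijective hp).1 h')
    have hq' : (q : ℝ) ≠ 0 := by exact_mod_cast hq
    have h3 : v.1 = v'.1 := (Prod.ext_iff.1 h2).1
    have h4 : q * v.2 = q * v'.2 := (Prod.ext_iff.1 h2).2
    exact Prod.ext h3 (mul_left_cancel₀ hq' h4)
  isEmbedding := by
    -- The torus is compact and `X` is Hausdorff, so injectivity suffices.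
    refine ((Φ.contMDiff_multisection hw hw1).continuous.isClosedEmbedding ?_).isEmbedding
    intro y y' h
    obtain ⟨h1, h2⟩ := Φ.point_injective (hw1 _) (hw1 _) h
    obtain ⟨h3, h4⟩ := Prod.ext_iff.1 h1
    exact Prod.ext h3 (hinj _ _ h4 h2)

end Smooth

theorem multisection_one_zero : Φ.multisection 1 0 = Φ.core := by
  ext y
  simp only [multisection, pow_one]
  rfl

theorem areaDensity_core (Ω : TwoForm X) (s t : ℝ) :
    areaDensity Ω Φ.core s t = Φ.pullback Ω ((s, t), 0) dirS dirT := by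
  have hw : ContMDiff (𝓡 1) 𝓘(ℝ, ℂ) ∞ (0 : Circle → ℂ) := contMDiff_const
  rw [← multisection_one_zero, Φ.areaDensity_multisection Ω hw (by simp)]
  have h0 : Φ.pullback Ω ((s, t), 0) dirS 0 = 0 := by
    simpa using Φ.pullback_smul_right Ω ((s, t), 0) dirS 0 0
  have e : ((0, 0) : Coord) = 0 := rfl
  simp [e, h0]

/-- Radial shrinking of `w` stays inside the disc and ends at the core precomposed with `torusPow
q`. -/
theorem torusClass_multisection {q : ℕ} {w : Circle → ℂ} (hw : Continuous w)
    (hw1 : ∀ b, ‖w b‖ < 1) (f : C(Torus, X)) (hf : ⇑f = Φ.multisection q w) :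
    torusClass f = (q : ℤ) • torusClass Φ.core := by
  rw [← torusClass_comp_torusPow]
  refine torusClass_eq_of_homotopic (ContinuousMap.Homotopic.symm ⟨⟨⟨fun x : unitInterval × Torus =>
    Φ.point (torusPow q x.2) ((x.1 : ℝ) * w x.2.2), ?_⟩, fun y => ?_, fun y => ?_⟩⟩)
  · refine Φ.contMDiffOn_point.continuousOn.comp_continuous
      (f := fun x : unitInterval × Torus => (torusPow q x.2, ((x.1 : ℝ) : ℂ) * w x.2.2))
      (by fun_prop) fun x => ?_
    rw [mem_ofPred_eq, norm_mul, Complex.norm_real, Real.norm_eq_abs, abs_of_nonneg x.1.2.1]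
    exact (mul_le_of_le_one_left (norm_nonneg _) x.1.2.2).trans_lt (hw1 _)
  · change Φ.point (torusPow q y) (((0 : ℝ) : ℂ) * w y.2) = _
    rw [Complex.ofReal_zero, zero_mul]
    rfl
  · simp [hf, multisection, torusPow]

end FramedNeighbourhood

end Multisections


/-! ### The closed braid as one loop traversing `q` turns -/

namespace ClosedBraid

variable {q : ℕ} (β : ClosedBraid q) {j : Fin q}

/-- The strand number `j` of a closed braid, traversed `q` times, as a function on the circle. -/
def loop (j : Fin q) (b : Circle) : ℂ := β.strand (q * Complex.arg b / (2 * Real.pi)) j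

theorem norm_loop_lt (j : Fin q) (b : Circle) : ‖β.loop j b‖ < 1 := β.norm_lt _ _

/-- The `2π` ambiguity of the argument becomes a multiple of `q` in braid time, which the period
absorbs. -/
theorem loop_exp (hper : ∀ t, β.strand (t + q) j = β.strand t j) (t : ℝ) :
    β.loop j (Circle.exp t) = β.strand (q * t / (2 * Real.pi)) j := by
  obtain ⟨m, hm⟩ := Circle.exp_eq_exp.1 (Circle.exp_arg (Circle.exp t))
  have hp : Function.Periodic (fun t => β.strand t j) q := hper
  have e := hp.int_mul m (q * t / (2 * Real.pi))
  rw [loop, hm, ← e]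
  congr 1
  field_simp

theorem contMDiff_loop (hper : ∀ t, β.strand (t + q) j = β.strand t j) :
    ContMDiff (𝓡 1) 𝓘(ℝ, ℂ) ∞ (β.loop j) := by
  intro b
  obtain ⟨t, rfl⟩ := Circle.exp_surjective b
  have h : ContDiff ℝ ∞ fun u : ℝ => β.strand (q * u / (2 * Real.pi)) j :=
    (contDiff_pi.1 β.smooth j).comp (by fun_prop)
  have e : β.loop j = (fun u : ℝ => β.strand (q * u / (2 * Real.pi)) j) ∘ angleNear t := by
    ext z
    rw [Function.comp_apply, ← β.loop_exp hper, exp_angleNear]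
  rw [e]
  exact h.contMDiff.contMDiffAt.comp _ (contMDiffAt_angleNear t)

/-- Equal `q`-th powers mean braid times differing by an integer `m`; equal positions then force `q
∣ m`, a full turn of `b`. -/
theorem loop_injective (hq : q ≠ 0) (hper : ∀ t, β.strand (t + q) j = β.strand t j)
    (hdvd : ∀ (t : ℝ) (m : ℤ), β.strand (t + m) j = β.strand t j → (q : ℤ) ∣ m)
    {b b' : Circle} (hb : b ^ q = b' ^ q) (h : β.loop j b = β.loop j b') : b = b' := by
  obtain ⟨t, rfl⟩ := Circle.exp_surjective b
  obtain ⟨t', rfl⟩ := Circle.exp_surjective b'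
  have hq' : (q : ℝ) ≠ 0 := by exact_mod_cast hq
  rw [← Circle.exp_natCast_mul, ← Circle.exp_natCast_mul] at hb
  obtain ⟨m, hm⟩ := Circle.exp_eq_exp.1 hb
  rw [β.loop_exp hper, β.loop_exp hper, hm] at h
  obtain ⟨k, rfl⟩ := hdvd (q * t' / (2 * Real.pi)) m (by
    rw [← h]; congr 1; field_simp)
  refine Circle.exp_eq_exp.2 ⟨k, mul_left_cancel₀ hq' ?_⟩
  rw [hm]
  push_cast
  ring

theorem range_loop (hq : q ≠ 0) (hper : ∀ t, β.strand (t + q) j = β.strand t j)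
    (hall : ∀ i, ∃ m : ℕ, ∀ t, β.strand t i = β.strand (t + m) j) (y : Circle) (z : ℂ) :
    (∃ b : Circle, b ^ q = y ∧ β.loop j b = z) ↔
      ∃ (t : ℝ) (i : Fin q), Circle.exp (2 * Real.pi * t) = y ∧ β.strand t i = z := by
  have hq' : (q : ℝ) ≠ 0 := by exact_mod_cast hq
  constructor
  · rintro ⟨b, rfl, rfl⟩
    obtain ⟨t, rfl⟩ := Circle.exp_surjective b
    refine ⟨q * t / (2 * Real.pi), j, ?_, (β.loop_exp hper t).symm⟩
    rw [← Circle.exp_natCast_mul]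
    congr 1
    field_simp
  · rintro ⟨t, i, rfl, rfl⟩
    obtain ⟨m, hm⟩ := hall i
    -- The loop is at braid time `q u / 2π` when its angle is `u`; this angle corresponds to time `t
    -- + m`.
    refine ⟨Circle.exp (2 * Real.pi * (t + m) / q), ?_, ?_⟩
    · rw [← Circle.exp_natCast_mul]
      refine Circle.exp_eq_exp.2 ⟨m, ?_⟩
      push_cast
      field_simp
    · rw [β.loop_exp hper, hm]
      congr 1
      field_simp

end ClosedBraid


/-! ### Sign of the area density: orthogonal slices and small `ε` -/

section Orientation

open Filter Topology

theorem mul_pos_of_isPreconnected {T : Type*} [TopologicalSpace T] {S : Set T}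
    (hS : IsPreconnected S) {g : T → ℝ} (hg : ContinuousOn g S) (h0 : ∀ x ∈ S, g x ≠ 0)
    {x y : T} (hx : x ∈ S) (hy : y ∈ S) : 0 < g x * g y := by
  by_contra! h
  have hmem : (0 : ℝ) ∈ uIcc (g x) (g y) := by
    rw [mem_uIcc]
    rcases le_total (g x) 0 with h1 | h1 <;> rcases le_total (g y) 0 with h2 | h2
    · exact absurd (le_antisymm h (mul_nonneg_of_nonpos_of_nonpos h1 h2))
        (mul_ne_zero (h0 x hx) (h0 y hy))
    · exact Or.inl ⟨h1, h2⟩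
    · exact Or.inr ⟨h2, h1⟩
    · exact absurd (le_antisymm h (mul_nonneg h1 h2)) (mul_ne_zero (h0 x hx) (h0 y hy))
  obtain ⟨z, hz, hz0⟩ := ((hS.image g hg).ordConnected.uIcc_subset
    (mem_image_of_mem g hx) (mem_image_of_mem g hy)) hmem
  exact h0 z hz hz0

section

variable {X : Type} [TopologicalSpace X] [ChartedSpace E4 X]

/-- The velocity of the loop `g` at the angle `s`. -/
def loopVelocity (g : Circle → X) (s : ℝ) : E4 :=
  mfderiv 𝓘(ℝ, ℝ) (𝓡 4) (fun u : ℝ => g (Circle.exp u)) s (1 : ℝ)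

/-- The parametrised loop is invariant under the shift by `s' - s`, so its velocities at the two
angles agree. -/
theorem loopVelocity_congr (g : Circle → X)
    (hg : MDifferentiable 𝓘(ℝ, ℝ) (𝓡 4) fun u : ℝ => g (Circle.exp u)) {s s' : ℝ}
    (h : Circle.exp s = Circle.exp s') : loopVelocity g s = loopVelocity g s' := by
  have e : (fun u : ℝ => g (Circle.exp u)) =
      (fun u : ℝ => g (Circle.exp u)) ∘ fun u => u + (s' - s) := by
    ext u
    rw [Function.comp_apply, Circle.exp_add, Circle.exp_sub, h, div_self', mul_one]
  have hadd : HasMFDerivAt 𝓘(ℝ, ℝ) 𝓘(ℝ, ℝ) (fun u => u + (s' - s)) s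
      (ContinuousLinearMap.id ℝ ℝ) := ((hasFDerivAt_id s).add_const (s' - s)).hasMFDerivAt
  have hg' : HasMFDerivAt 𝓘(ℝ, ℝ) (𝓡 4) (fun u : ℝ => g (Circle.exp u)) (s + (s' - s))
      (mfderiv 𝓘(ℝ, ℝ) (𝓡 4) (fun u : ℝ => g (Circle.exp u)) s') := by
    rw [add_sub_cancel]
    exact (hg s').hasMFDerivAt
  have := (HasMFDerivAt.comp s hg' hadd).mfderiv
  rw [← e] at this
  exact DFunLike.congr_fun this (1 : ℝ)

theorem areaDensity_congr (Ω : TwoForm X) {f : Torus → X} (hf : ContMDiff torusModel (𝓡 4) ∞ f)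
    {s t s' t' : ℝ} (hs : Circle.exp s = Circle.exp s') (ht : Circle.exp t = Circle.exp t') :
    areaDensity Ω f s t = areaDensity Ω f s' t' := by
  have hcd := hf.comp contMDiff_torusExp
  have h1 : MDifferentiable 𝓘(ℝ, ℝ) (𝓡 4) fun u : ℝ => f (Circle.exp u, Circle.exp t) :=
    (hcd.comp (contDiff_prodMk_left t).contMDiff).mdifferentiable (by simp)
  have h2 : MDifferentiable 𝓘(ℝ, ℝ) (𝓡 4) fun u : ℝ => f (Circle.exp s, Circle.exp u) :=
    (hcd.comp (contDiff_prodMk_right s).contMDiff).mdifferentiable (by simp)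
  let Ω' : X → E4 [⋀^Fin 2]→L[ℝ] ℝ := Ω
  let A : Torus → ℝ → E4 := fun y => loopVelocity fun a => f (a, y.2)
  let B : Torus → ℝ → E4 := fun y => loopVelocity fun b => f (y.1, b)
  change Ω' (f (Circle.exp s, Circle.exp t)) ![A (Circle.exp s, Circle.exp t) s,
    B (Circle.exp s, Circle.exp t) t] = Ω' (f (Circle.exp s', Circle.exp t'))
      ![A (Circle.exp s', Circle.exp t') s', B (Circle.exp s', Circle.exp t') t']
  have e1 : A (Circle.exp s, Circle.exp t) s = A (Circle.exp s, Circle.exp t) s' :=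
    loopVelocity_congr (fun a => f (a, Circle.exp t)) h1 hs
  have e2 : B (Circle.exp s, Circle.exp t) t = B (Circle.exp s, Circle.exp t) t' :=
    loopVelocity_congr (fun b => f (Circle.exp s, b)) h2 ht
  rw [e1, e2, hs, ht]

end

namespace FramedNeighbourhood

variable {X : Type} [TopologicalSpace X] [ChartedSpace E4 X] (Φ : FramedNeighbourhood X)

theorem pullback_eq_zero_of_hasOrthogonalSlices {Ω : TwoForm X} (h : Φ.HasOrthogonalSlices Ω)
    {p : Coord} (hp : p ∈ solid) (u : ℝ × ℝ) (v : ℂ) : Φ.pullback Ω p (u, 0) (0, v) = 0 := by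
  obtain ⟨x, z⟩ := p
  have hz : ‖z‖ < 1 := hp
  have hslice : ContMDiff torusModel (𝓡 4) ∞ (fun y => Φ.point y z) :=
    Φ.contMDiffOn_point.comp_contMDiff (contMDiff_id.prodMk contMDiff_const) fun _ => hz
  have hcov := (Φ.mdifferentiableAt_cover hp).hasMFDerivAt
  have i1 : HasMFDerivAt 𝓘(ℝ, ℝ × ℝ) 𝓘(ℝ, Coord) (fun x' : ℝ × ℝ => ((x', z) : Coord)) x
      ((ContinuousLinearMap.id ℝ (ℝ × ℝ)).prod 0) :=
    ((hasFDerivAt_id x).prodMk (hasFDerivAt_const z x)).hasMFDerivAt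
  have i2 : HasMFDerivAt 𝓘(ℝ, ℂ) 𝓘(ℝ, Coord) (fun z' : ℂ => ((x, z') : Coord)) z
      (ContinuousLinearMap.prod 0 (ContinuousLinearMap.id ℝ ℂ)) :=
    ((hasFDerivAt_const x z).prodMk (hasFDerivAt_id z)).hasMFDerivAt
  have e1 := DFunLike.congr_fun (HasMFDerivAt.comp x hcov i1).mfderiv u
  have e2 := DFunLike.congr_fun (HasMFDerivAt.comp z hcov i2).mfderiv v
  have e3 := mfderiv_comp_torusExp hslice x u
  have := h (torusExp x) z hz (mfderiv 𝓘(ℝ, ℝ × ℝ) torusModel torusExp x u) v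
  rw [← e3] at this
  refine Eq.trans ?_ this
  let Ω' : X → E4 [⋀^Fin 2]→L[ℝ] ℝ := Ω
  exact congrArg₂ (fun a b : E4 => Ω' (Φ.point (torusExp x) z) ![a, b]) e1.symm e2.symm

/-- The field `∂/∂s` pairs to zero with itself and with all disc directions; if it did so with
`∂/∂t` too, the form would be degenerate. -/
theorem pullback_dirS_dirT_ne_zero {Ω : TwoForm X} (hΩ : IsSymplecticForm Ω)
    (h : Φ.HasOrthogonalSlices Ω) {p : Coord} (hp : p ∈ solid) :
    Φ.pullback Ω p dirS dirT ≠ 0 := by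
  intro h0
  have hS : dirS ≠ 0 := fun e => one_ne_zero (congrArg (fun p : Coord => p.1.1) e)
  obtain ⟨v, hv⟩ := Φ.pullback_nondegenerate hΩ hp hS
  have hdec : v = v.1.1 • dirS + v.1.2 • dirT + (0, v.2) := by
    refine Prod.ext (Prod.ext ?_ ?_) ?_ <;> simp [dirS, dirT]
  rw [hdec, pullback_add_right, pullback_add_right, pullback_smul_right, pullback_smul_right,
    pullback_self, h0, dirS, Φ.pullback_eq_zero_of_hasOrthogonalSlices h hp] at hv
  simp at hv

variable [IsManifold (𝓡 4) ∞ X] {q : ℕ} {w : Circle → ℂ} {Ω : TwoForm X}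

theorem continuousOn_pullback_dirS_dirT (hΩ : IsSymplecticForm Ω) :
    ContinuousOn (fun p => Φ.pullback Ω p dirS dirT) solid :=
  (Φ.continuousOn_pullback hΩ).comp (f := fun p : Coord => (p, dirS, dirT)) (by fun_prop)
    fun _ hp => ⟨hp, mem_univ _⟩

/-- If the slices are orthogonal, every multisection has the orientation of the core. -/
theorem sameOrientation_of_hasOrthogonalSlices (hΩ : IsSymplecticForm Ω)
    (h : Φ.HasOrthogonalSlices Ω) (hq : q ≠ 0) (hw : ContMDiff (𝓡 1) 𝓘(ℝ, ℂ) ∞ w)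
    (hw1 : ∀ b, ‖w b‖ < 1) : SameOrientation Ω (Φ.multisection q w) Φ.core := by
  intro s t s' t'
  have hp : (((s, q * t), w (Circle.exp t)) : Coord) ∈ solid := hw1 _
  have hp' : (((s', t'), 0) : Coord) ∈ solid := by simp [solid]
  rw [areaDensity_core, Φ.areaDensity_multisection Ω hw hw1]
  conv in Φ.pullback Ω _ dirS (0, _) => rw [dirS]
  rw [Φ.pullback_eq_zero_of_hasOrthogonalSlices h hp, add_zero, mul_assoc]
  exact mul_pos (by exact_mod_cast Nat.pos_of_ne_zero hq)
    (mul_pos_of_isPreconnected isPreconnected_solid (Φ.continuousOn_pullback_dirS_dirT hΩ)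
      (fun p hp => Φ.pullback_dirS_dirT_ne_zero hΩ h hp) hp hp')

theorem areaDensity_core_mul_pos (hΩ : IsSymplecticForm Ω) (hF : IsSymplecticMap Ω Φ.core)
    (s t s' t' : ℝ) : 0 < areaDensity Ω Φ.core s t * areaDensity Ω Φ.core s' t' := by
  have hcore : ContMDiff torusModel (𝓡 4) ∞ Φ.core := by
    rw [← multisection_one_zero]
    exact Φ.contMDiff_multisection contMDiff_const (by simp)
  have hne := (isSymplecticMap_iff Ω hcore).1 hF
  simp only [areaDensity_core] at hne ⊢
  refine mul_pos_of_isPreconnected (S := univ) (x := (s, t)) (y := (s', t'))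
    (g := fun x : ℝ × ℝ => Φ.pullback Ω (x, 0) dirS dirT) isPreconnected_univ ?_
    (fun x _ => hne x.1 x.2) (mem_univ _) (mem_univ _)
  exact (Φ.continuousOn_pullback_dirS_dirT hΩ).comp (by fun_prop) fun x _ => by simp [solid]

/-- Multisections close to the core have the orientation of the core. -/
theorem exists_sameOrientation (hΩ : IsSymplecticForm Ω) (hF : IsSymplecticMap Ω Φ.core)
    (hq : q ≠ 0) (hw : ContMDiff (𝓡 1) 𝓘(ℝ, ℂ) ∞ w) (hw1 : ∀ b, ‖w b‖ < 1) :
    ∃ ε₀ : ℝ, 0 < ε₀ ∧ ∀ ε : ℝ, 0 < ε → ε ≤ 1 → ε ≤ ε₀ →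
      SameOrientation Ω (Φ.multisection q fun b => ε * w b) Φ.core := by
  let z : ℝ → ℂ := fun u => w (Circle.exp u)
  have hzs : ContDiff ℝ ∞ z := (hw.comp contMDiff_circleExp).contDiff
  have hz' : Continuous (deriv z) := hzs.continuous_deriv (by simp)
  have hscale : ∀ ε : ℝ, ContMDiff (𝓡 1) 𝓘(ℝ, ℂ) ∞ fun b => (ε : ℂ) * w b := fun ε =>
    (contDiff_const.mul contDiff_id).contMDiff.comp hw
  have hnorm : ∀ ε : ℝ, 0 < ε → ε ≤ 1 → ∀ b, ‖(ε : ℂ) * w b‖ < 1 := fun ε h0 h1 b => by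
    rw [norm_mul, Complex.norm_real, Real.norm_eq_abs, abs_of_pos h0]
    exact (mul_le_of_le_one_left (norm_nonneg _) h1).trans_lt (hw1 b)
  let c := areaDensity Ω Φ.core 0 0
  let P : ℝ → ℝ × ℝ → Coord := fun ε x => ((x.1, q * x.2), ε * z x.2)
  -- The density formula of the scaled multisection, continued to `ε = 0`, where it is `q` times the
  -- core density. The sign of `c` is the reference orientation.
  let G : ℝ → ℝ × ℝ → ℝ := fun ε x => q * Φ.pullback Ω (P ε x) dirS dirT +
    Φ.pullback Ω (P ε x) dirS (0, ε * deriv z x.2)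
  have hdens : ∀ ε : ℝ, 0 < ε → ε ≤ 1 → ∀ s t,
      areaDensity Ω (Φ.multisection q fun b => ε * w b) s t = G ε (s, t) := by
    intro ε h0 h1 s t
    rw [Φ.areaDensity_multisection Ω (hscale ε) (hnorm ε h0 h1)]
    simp only [G, P, z]
    rw [deriv_const_mul _ (hzs.differentiable (by simp) t)]
  have hG0 : ∀ x, 0 < G 0 x * c := by
    intro x
    have e0 : Φ.pullback Ω (P 0 x) dirS (0, ((0 : ℝ) : ℂ) * deriv z x.2) = 0 := by
      have := Φ.pullback_smul_right Ω (P 0 x) dirS 0 0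
      rw [zero_mul, zero_smul] at this
      rw [Complex.ofReal_zero, zero_mul]
      exact this
    have e1 : Φ.pullback Ω (P 0 x) dirS dirT = areaDensity Ω Φ.core x.1 (q * x.2) := by
      rw [areaDensity_core]
      simp [P]
    simp only [G]
    rw [e0, e1, add_zero, mul_assoc]
    exact mul_pos (by exact_mod_cast Nat.pos_of_ne_zero hq)
      (Φ.areaDensity_core_mul_pos hΩ hF _ _ _ _)
  have hG : ∀ x, ∀ᶠ y : ℝ × (ℝ × ℝ) in 𝓝 (0, x), 0 < G y.1 y.2 * c := by
    intro x
    have hPc : Continuous fun y : ℝ × (ℝ × ℝ) => P y.1 y.2 := by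
      have := hzs.continuous
      fun_prop
    have hmem : P 0 x ∈ solid := by simp [P, solid]
    have hpb := fun v => (Φ.continuousOn_pullback hΩ).continuousAt (x := (P 0 x, dirS, v))
      ((isOpen_solid.prod isOpen_univ).mem_nhds ⟨hmem, mem_univ _⟩)
    have c1 : ContinuousAt (fun y : ℝ × (ℝ × ℝ) => Φ.pullback Ω (P y.1 y.2) dirS dirT) (0, x) :=
      (hpb dirT).comp_of_eq (f := fun y : ℝ × (ℝ × ℝ) => (P y.1 y.2, dirS, dirT))
        (by fun_prop) rfl
    have c2 : ContinuousAt (fun y : ℝ × (ℝ × ℝ) => Φ.pullback Ω (P y.1 y.2) dirS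
        (0, y.1 * deriv z y.2.2)) (0, x) :=
      (hpb (0, ((0 : ℝ) : ℂ) * deriv z x.2)).comp_of_eq
        (f := fun y : ℝ × (ℝ × ℝ) => (P y.1 y.2, dirS, ((0, y.1 * deriv z y.2.2) : Coord)))
        (by fun_prop) rfl
    exact (((continuousAt_const.mul c1).add c2).mul continuousAt_const).eventually
      (lt_mem_nhds (hG0 x))
  -- One period square represents the whole torus; its compactness gives a single `δ` for all
  -- points.
  have hK : IsCompact (Icc (0 : ℝ) (2 * Real.pi) ×ˢ Icc (0 : ℝ) (2 * Real.pi)) :=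
    isCompact_Icc.prod isCompact_Icc
  have hev := hK.eventually_forall_of_forall_eventually (x₀ := (0 : ℝ))
    (P := fun ε x => 0 < G ε x * c) fun x _ => hG x
  obtain ⟨δ, hδ, hball⟩ := Metric.eventually_nhds_iff.1 hev
  -- Halving turns the bound `ε ≤ ε₀` into the strict one needed for the ball.
  refine ⟨δ / 2, by positivity, fun ε h0 h1 hε s t s' t' => ?_⟩
  have red : ∀ u : ℝ, ∃ v ∈ Icc (0 : ℝ) (2 * Real.pi), Circle.exp u = Circle.exp v := by
    intro u
    obtain ⟨v, hv, e⟩ := Circle.periodic_exp.exists_mem_Ico₀ Real.two_pi_pos u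
    exact ⟨v, ⟨hv.1, hv.2.le⟩, e⟩
  obtain ⟨s₁, hs₁, es⟩ := red s
  obtain ⟨t₁, ht₁, et⟩ := red t
  rw [areaDensity_congr Ω (Φ.contMDiff_multisection (hscale ε) (hnorm ε h0 h1)) es et,
    hdens ε h0 h1]
  have hpos : 0 < G ε (s₁, t₁) * c := hball (by
    rw [Real.dist_eq, sub_zero, abs_of_pos h0]; linarith) (s₁, t₁) ⟨hs₁, ht₁⟩
  have hcc := Φ.areaDensity_core_mul_pos hΩ hF 0 0 s' t'
  have hc2 : 0 < c * c := Φ.areaDensity_core_mul_pos hΩ hF 0 0 0 0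
  -- Both densities have been compared with `c`; the factor `c * c > 0` chains the two comparisons.
  refine pos_of_mul_pos_left (b := c * c) ?_ hc2.le
  calc 0 < (G ε (s₁, t₁) * c) * (c * areaDensity Ω Φ.core s' t') := mul_pos hpos hcc
    _ = _ := by ring

end FramedNeighbourhood

theorem SameOrientation.isSymplecticMap {X : Type} [TopologicalSpace X] [ChartedSpace E4 X]
    {Ω : TwoForm X} {f g : Torus → X} (h : SameOrientation Ω f g)
    (hf : ContMDiff torusModel (𝓡 4) ∞ f) : IsSymplecticMap Ω f :=
  (isSymplecticMap_iff Ω hf).2 fun s t => left_ne_zero_of_mul (h s t s t).ne'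

end Orientation

end BraidTori
end
-- The braided torus as the multisection of the scaled loop
theorem lemma2p2 {X : Type} [TopologicalSpace X] [T2Space X] [SecondCountableTopology X]
    [ChartedSpace BraidTori.E4 X] [IsManifold (𝓡 4) ∞ X]
    (Ω : BraidTori.TwoForm X) (hΩ : BraidTori.IsSymplecticForm Ω)
    (Φ : BraidTori.FramedNeighbourhood X) (hF : BraidTori.IsSymplecticMap Ω Φ.core)
    (p q : ℕ) (hp : 1 ≤ p) (hq : 2 ≤ q)
    (β : BraidTori.ClosedBraid q) (hβ : β.IsClosureB p) :
    ∃ ε₀ : ℝ, 0 < ε₀ ∧ ∀ ε : ℝ, 0 < ε → ε ≤ 1 →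
      ∃ f : C(BraidTori.Torus, X),
        BraidTori.IsSmoothTorus f ∧ Set.range f = Φ.braidTorus β ε ∧
        BraidTori.torusClass f = (q : ℤ) • BraidTori.torusClass Φ.core ∧
        (ε ≤ ε₀ ∨ Φ.HasOrthogonalSlices Ω →
          BraidTori.IsSymplecticMap Ω f ∧ BraidTori.SameOrientation Ω f Φ.core) := by
  obtain ⟨j, hper, hdvd, hall⟩ := hβ.exists_strand hp hq
  have hq0 : q ≠ 0 := by omega
  have hw := β.contMDiff_loop hper
  obtain ⟨ε₀, hε₀, hor⟩ := Φ.exists_sameOrientation hΩ hF hq0 hw (β.norm_loop_lt j)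
  refine ⟨ε₀, hε₀, fun ε h0 h1 => ?_⟩
  have hεw : ContMDiff (𝓡 1) 𝓘(ℝ, ℂ) ∞ fun b => (ε : ℂ) * β.loop j b :=
    (contDiff_const.mul contDiff_id).contMDiff.comp hw
  have hεw1 : ∀ b, ‖(ε : ℂ) * β.loop j b‖ < 1 := fun b => by
    rw [norm_mul, Complex.norm_real, Real.norm_eq_abs, abs_of_pos h0]
    exact (mul_le_of_le_one_left (norm_nonneg _) h1).trans_lt (β.norm_loop_lt j b)
  have hεc : (ε : ℂ) ≠ 0 := by exact_mod_cast h0.ne'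
  have hcd := Φ.contMDiff_multisection (q := q) hεw hεw1
  refine ⟨⟨Φ.multisection q fun b => ε * β.loop j b, hcd.continuous⟩,
    Φ.isSmoothTorus_multisection hq0 hεw hεw1 fun b b' hb h =>
      β.loop_injective hq0 hper hdvd hb (mul_left_cancel₀ hεc h), ?_,
    Φ.torusClass_multisection hεw.continuous hεw1 _ rfl, fun h => ?_⟩
  · ext x
    constructor
    · rintro ⟨⟨a, b⟩, rfl⟩
      obtain ⟨t, i, ht, hi⟩ := (β.range_loop hq0 hper hall _ _).1 ⟨b, rfl, rfl⟩
      exact ⟨a, t, i, by rw [ht, hi]; rfl⟩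
    · rintro ⟨a, t, i, rfl⟩
      obtain ⟨b, hb, hz⟩ := (β.range_loop hq0 hper hall _ _).2 ⟨t, i, rfl, rfl⟩
      exact ⟨(a, b), by rw [← hb, ← hz]; rfl⟩
  · have hso : BraidTori.SameOrientation Ω (Φ.multisection q fun b => ε * β.loop j b) Φ.core :=
      h.elim (hor ε h0 h1) fun h => Φ.sameOrientation_of_hasOrthogonalSlices hΩ h hq0 hεw hεw1
    exact ⟨hso.isSymplecticMap hcd, hso⟩
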